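/- Let $n\ge 1$ and let $G$ be the simply connected simple algebraic group over $\mathbb C$ of type $B_n$, with simple roots $\alpha_1,\dots,\alpha_n$ ($\alpha_n$ short), Chevalley generators $e_i,f_i,h_i$, simple reflections $s_i$, fundamental weights $\Lambda_i$, longest Weyl group element $w_0$, maximal torus $T$ and opposite maximal unipotent subgroups $U^+,U^-$. Put $x_i(t)=\exp(te_i)$, $y_i(t)=\exp(tf_i)$, let $\alpha_i^\vee(c)\in T$ ($c\in\mathbb C^\times$) be the coroot subgroup, $\bar s_i=x_i(-1)y_i(1)x_i(-1)$, and $\bar w=\bar s_{i_1}\cdots\bar s_{i_k}$ for any reduced word $w=s_{i_1}\cdots s_{i_k}$. Let $\Delta_{\Lambda_n}$ be the unique regular function on $G$ with $\Delta_{\Lambda_n}(u^-tu^+)=\Lambda_n(t)$ for $u^\pm\in U^\pm$, $t\in T$, and for $\gamma=u\Lambda_n$, $\delta=v\Lambda_n$ with $u,v$ in the Weyl group let $\Delta_{\gamma,\delta}(g)=\Delta_{\Lambda_n}(\bar u^{-1}g\bar v)$ be the generalized minor, which depends only on $\gamma$ and $\delta$. For $c=(c_i^{(j)})_{1\le i,j\le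 n}\in(\mathbb C^\times)^{n^2}$ and the word $\mathbf i_0=(1\,2\cdots n)^n$ put $$\Theta^-_{\mathbf i_0}(c)=\prod_{j=1,\dots,n}^{\rightarrow}\ \prod_{i=1,\dots,n}^{\rightarrow}\mathbf y_i\bigl(c_i^{(j)}\bigr),\qquad \mathbf y_i(c)=y_i(c)\,\alpha_i^\vee(c^{-1}),$$ where the factors are written from left to right in increasing order of $j$, and of $i$ for each $j$. A *triangle* is a family of integers $\delta=(j_k^{(l)})_{1\le k\le l\le n}$ with $1\le j_k^{(l)}\le n+1$ for all $1\le k\le l\le n$ and $j_k^{(l+1)}\le j_k^{(l)}<j_{k+1}^{(l+1)}$ for $1\le k\le l<n$; let $\triangle_n$ be the set of triangles and $\delta_l\in\triangle_n$ the triangle with $j_k^{(l)}=k$ for all $k,l$. For $\delta\in\triangle_n$ and $1\le k\le n$ there is a unique $s_k\in\{1,\dots,k+1\}$ such that $j_m^{(k)}=m$ for $m<s_k$ and $j_m^{(k)}=m+1$ for $s_k\le m\le k$. Put $s_0=1$ and $s_{n+1}=s_{n-1}+1$. The $k$-th row of $\delta$ is of type I if $s_{k+1}=s_k+1$, $s_k=s_{k-1}$;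 of type II if $s_{k+1}=s_k=s_{k-1}$; of type III if $s_{k+1}=s_k+1$, $s_k=s_{k-1}+1$; of type IV if $s_{k+1}=s_k$, $s_k=s_{k-1}+1$. Let $$m(\delta)=\prod_{i\text{-th row of type I}}c_i^{(s_i)}\prod_{i\text{-th row of type IV}}\bigl(c_i^{(s_i)}\bigr)^{-1},$$ and let $\overline{m(\delta)}$ be obtained from $m(\delta)$ by the substitution $c_i^{(j)}\mapsto\bigl(c_i^{(n-j+1)}\bigr)^{-1}$. Then $$\Delta_{w_0s_n\Lambda_n,\Lambda_n}\bigl(\Theta^-_{\mathbf i_0}(c)\bigr)=\sum_{\delta\in\triangle_n\setminus\{\delta_l\}}\overline{m(\delta)}\qquad\text{for all }c\in(\mathbb C^\times)^{n^2}.$$ -/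

import Mathlib

namespace TypeB

/-! ### Root data of type `B_n`

The index set `I = {1, …, n}` is `Fin n`; the element `i : Fin n` stands for the index `i + 1`. -/

/-- The index `n ∈ I`. -/
def lastIdx (n : ℕ) (hn : 1 ≤ n) : Fin n := ⟨n - 1, by omega⟩

/-- The Cartan matrix `a_{i,j} = α_j(h_i)` of type `B_n`; `α_n` is the short root. -/
def cartan (n : ℕ) (i j : Fin n) : ℤ :=
  if i = j then 2
  else if (i : ℕ) + 1 = j then -1
  else if (j : ℕ) + 1 = i then (if (i : ℕ) + 1 = n then -2 else -1)
  else 0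

/-- The weight lattice `P`; the weight `wt` is given by its values `wt i = ⟨h_i, wt⟩` on the simple
coroots, that is, by its coordinates in the basis of fundamental weights. -/
abbrev Weight (n : ℕ) : Type := Fin n → ℤ

/-- The fundamental weight `Λ_i`. -/
def fundWeight {n : ℕ} (i : Fin n) : Weight n := Pi.single i 1

/-- The simple root `α_j`. -/
def simpleRoot {n : ℕ} (j : Fin n) : Weight n := fun i => cartan n i j

theorem reflection_involutive {n : ℕ} (i : Fin n) :
    Function.Involutive (fun wt : Weight n => wt - wt i • simpleRoot i) := by
  intro wt
  funext k
  simp only [Pi.sub_apply, Pi.smul_apply, smul_eq_mul]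
  have h : (simpleRoot i : Weight n) i = 2 := by simp [simpleRoot, cartan]
  rw [h]
  ring

/-- The simple reflection `s_i : wt ↦ wt - ⟨h_i, wt⟩ α_i`. -/
def simpleReflection {n : ℕ} (i : Fin n) : Equiv.Perm (Weight n) :=
  (reflection_involutive i).toPerm

/-- The Weyl group. -/
def weylGroup (n : ℕ) : Subgroup (Equiv.Perm (Weight n)) :=
  Subgroup.closure (Set.range simpleReflection)

/-- The element `s_{i_1} ⋯ s_{i_k}` of the Weyl group given by a word `i_1 ⋯ i_k`. -/
def wordProd {n : ℕ} (a : List (Fin n)) : Equiv.Perm (Weight n) :=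
  (a.map simpleReflection).prod

/-- The length of an element of the Weyl group. -/
noncomputable def weylLength {n : ℕ} (w : Equiv.Perm (Weight n)) : ℕ :=
  sInf {k | ∃ a : List (Fin n), a.length = k ∧ wordProd a = w}

/-- A word is reduced if no shorter word gives the same element of the Weyl group. -/
def IsReducedWord {n : ℕ} (a : List (Fin n)) : Prop :=
  weylLength (wordProd a) = a.length

/-- `w₀` is the longest element of the Weyl group. -/
def IsLongest {n : ℕ} (w₀ : Equiv.Perm (Weight n)) : Prop :=
  w₀ ∈ weylGroup n ∧ ∀ w ∈ weylGroup n, weylLength w ≤ weylLength w₀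

/-! ### The spin representation -/

/-- The basis `(ε_1, …, ε_n)`, `ε_i ∈ {+, -}`, of the spin representation; `true` is `+`. -/
abbrev Spin (n : ℕ) : Type := Fin n → Bool

/-- The action of `e_i` on basis vectors (`none` is the zero vector). -/
def raise {n : ℕ} (i : Fin n) (ε : Spin n) : Option (Spin n) :=
  if h : (i : ℕ) + 1 < n then
    if ε i = false ∧ ε ⟨i + 1, h⟩ = true then
      some (Function.update (Function.update ε i true) ⟨i + 1, h⟩ false)
    else none
  else if ε i = false then some (Function.update ε i true) else none

/-- The action of `f_i` on basis vectors (`none` is the zero vector). -/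
def lower {n : ℕ} (i : Fin n) (ε : Spin n) : Option (Spin n) :=
  if h : (i : ℕ) + 1 < n then
    if ε i = true ∧ ε ⟨i + 1, h⟩ = false then
      some (Function.update (Function.update ε i false) ⟨i + 1, h⟩ true)
    else none
  else if ε i = true then some (Function.update ε i false) else none

/-- The eigenvalue of `h_i` on the basis vector `ε`: it is `(ε_i - ε_{i+1}) / 2` for `i ≠ n`,
and `ε_n` for `i = n`. -/
def hval {n : ℕ} (i : Fin n) (ε : Spin n) : ℤ :=
  if h : (i : ℕ) + 1 < n then
    if ε i = true ∧ ε ⟨i + 1, h⟩ = false then 1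
    else if ε i = false ∧ ε ⟨i + 1, h⟩ = true then -1
    else 0
  else if ε i = true then 1 else -1

/-- The matrix of `e_i` in the basis `Spin n`. -/
def eMat {n : ℕ} (i : Fin n) : Matrix (Spin n) (Spin n) ℂ :=
  Matrix.of fun ε' ε => if raise i ε = some ε' then 1 else 0

/-- The matrix of `f_i` in the basis `Spin n`. -/
def fMat {n : ℕ} (i : Fin n) : Matrix (Spin n) (Spin n) ℂ :=
  Matrix.of fun ε' ε => if lower i ε = some ε' then 1 else 0

theorem raise_raise {n : ℕ} (i : Fin n) (ε ε' : Spin n) (h : raise i ε = some ε') :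
    raise i ε' = none := by
  unfold raise at h ⊢
  split_ifs at h ⊢ <;> simp_all
  · subst h; simp_all [Fin.ext_iff]
  · subst h; simp_all

theorem lower_lower {n : ℕ} (i : Fin n) (ε ε' : Spin n) (h : lower i ε = some ε') :
    lower i ε' = none := by
  unfold lower at h ⊢
  split_ifs at h ⊢ <;> simp_all
  · subst h; simp_all [Fin.ext_iff]
  · subst h; simp_all

theorem eMat_mul_self {n : ℕ} (i : Fin n) : eMat i * eMat i = 0 := by
  ext a b
  simp only [eMat, Matrix.mul_apply, Matrix.of_apply, Matrix.zero_apply]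
  refine Finset.sum_eq_zero fun k _ => ?_
  by_cases h : raise i b = some k
  · simp [raise_raise i b k h]
  · simp [h]

theorem fMat_mul_self {n : ℕ} (i : Fin n) : fMat i * fMat i = 0 := by
  ext a b
  simp only [fMat, Matrix.mul_apply, Matrix.of_apply, Matrix.zero_apply]
  refine Finset.sum_eq_zero fun k _ => ?_
  by_cases h : lower i b = some k
  · simp [lower_lower i b k h]
  · simp [h]

theorem isNilpotent_smul_eMat {n : ℕ} (i : Fin n) (t : ℂ) : IsNilpotent (t • eMat i) :=
  ⟨2, by rw [sq, smul_mul_smul_comm, eMat_mul_self, smul_zero]⟩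

theorem isNilpotent_smul_fMat {n : ℕ} (i : Fin n) (t : ℂ) : IsNilpotent (t • fMat i) :=
  ⟨2, by rw [sq, smul_mul_smul_comm, fMat_mul_self, smul_zero]⟩

/-! ### The group `G`

The simply connected simple algebraic group `G` over `ℂ` of type `B_n` is realized as the Chevalley
group of the spin representation. This representation is faithful, because its weights generate the
weight lattice. -/

/-- `exp (t e_i)`. -/
noncomputable def expE {n : ℕ} (i : Fin n) (t : ℂ) : Matrix.GeneralLinearGroup (Spin n) ℂ where
  val := IsNilpotent.exp (t • eMat i)
  inv := IsNilpotent.exp (-(t • eMat i))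
  val_inv := IsNilpotent.exp_mul_exp_neg_self (isNilpotent_smul_eMat i t)
  inv_val := IsNilpotent.exp_neg_mul_exp_self (isNilpotent_smul_eMat i t)

/-- `exp (t f_i)`. -/
noncomputable def expF {n : ℕ} (i : Fin n) (t : ℂ) : Matrix.GeneralLinearGroup (Spin n) ℂ where
  val := IsNilpotent.exp (t • fMat i)
  inv := IsNilpotent.exp (-(t • fMat i))
  val_inv := IsNilpotent.exp_mul_exp_neg_self (isNilpotent_smul_fMat i t)
  inv_val := IsNilpotent.exp_neg_mul_exp_self (isNilpotent_smul_fMat i t)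

/-- `c ^ h_i`, the diagonal matrix acting on each basis vector by `c` to the power of the
eigenvalue of `h_i`. -/
def powH {n : ℕ} (i : Fin n) (c : ℂˣ) : Matrix.GeneralLinearGroup (Spin n) ℂ where
  val := Matrix.diagonal fun ε => ((c ^ hval i ε : ℂˣ) : ℂ)
  inv := Matrix.diagonal fun ε => ((c ^ (-hval i ε) : ℂˣ) : ℂ)
  val_inv := by
    rw [Matrix.diagonal_mul_diagonal, ← Matrix.diagonal_one]
    congr 1
    funext ε
    rw [← Units.val_mul, ← zpow_add, add_neg_cancel, zpow_zero, Units.val_one]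
  inv_val := by
    rw [Matrix.diagonal_mul_diagonal, ← Matrix.diagonal_one]
    congr 1
    funext ε
    rw [← Units.val_mul, ← zpow_add, neg_add_cancel, zpow_zero, Units.val_one]

/-- The group `G`, generated by the one-parameter subgroups of the simple and the negative simple
roots, and by the maximal torus. -/
def G (n : ℕ) : Subgroup (Matrix.GeneralLinearGroup (Spin n) ℂ) :=
  Subgroup.closure
    ({g | ∃ (i : Fin n) (t : ℂ), g = expE i t} ∪ {g | ∃ (i : Fin n) (t : ℂ), g = expF i t} ∪
      {g | ∃ (i : Fin n) (c : ℂˣ), g = powH i c})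

/-- `x_i(t) = exp (t e_i) ∈ G`. -/
noncomputable def xSub {n : ℕ} (i : Fin n) (t : ℂ) : G n :=
  ⟨expE i t, Subgroup.subset_closure (Or.inl (Or.inl ⟨i, t, rfl⟩))⟩

/-- `y_i(t) = exp (t f_i) ∈ G`. -/
noncomputable def ySub {n : ℕ} (i : Fin n) (t : ℂ) : G n :=
  ⟨expF i t, Subgroup.subset_closure (Or.inl (Or.inr ⟨i, t, rfl⟩))⟩

/-- `α_i^∨(c) = c ^ h_i ∈ G`. -/
def alphaCheck {n : ℕ} (i : Fin n) (c : ℂˣ) : G n :=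
  ⟨powH i c, Subgroup.subset_closure (Or.inr ⟨i, c, rfl⟩)⟩

/-- The maximal unipotent subgroup `U = U⁺`. It is generated by the root subgroups of the simple roots
(these generate the root subgroups of all the positive roots). -/
def Uplus (n : ℕ) : Subgroup (G n) :=
  Subgroup.closure {g | ∃ (i : Fin n) (t : ℂ), g = xSub i t}

/-- The opposite maximal unipotent subgroup `U⁻`, generated likewise. -/
def Uminus (n : ℕ) : Subgroup (G n) :=
  Subgroup.closure {g | ∃ (i : Fin n) (t : ℂ), g = ySub i t}

/-- The element `∏ α_i^∨(t_i)` of the maximal torus `T`; as `G` is simply connected, each element of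
`T` is of this form, and a weight `μ` takes on it the value `∏ t_i ^ ⟨h_i, μ⟩`. -/
def torus {n : ℕ} (t : Fin n → ℂˣ) : G n :=
  (List.ofFn fun i => alphaCheck i (t i)).prod

/-- The representative `s̄_i = x_i(-1) y_i(1) x_i(-1)` of `s_i`. -/
noncomputable def sbar {n : ℕ} (i : Fin n) : G n :=
  xSub i (-1) * ySub i 1 * xSub i (-1)

/-- The product `s̄_{i_1} ⋯ s̄_{i_k}`; for a reduced word this is the representative `w̄` of
`w = s_{i_1} ⋯ s_{i_k}`. -/
noncomputable def wordLift {n : ℕ} (a : List (Fin n)) : G n := (a.map sbar).prod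

/-! ### Generalized minors -/

/-- A regular function on `G`: a polynomial in the matrix entries (the determinant is `1` on `G`). -/
def IsRegular {n : ℕ} (D : G n → ℂ) : Prop :=
  ∃ p : MvPolynomial (Spin n × Spin n) ℂ, ∀ g : G n,
    D g = MvPolynomial.eval (fun ab => (g : Matrix.GeneralLinearGroup (Spin n) ℂ) ab.1 ab.2) p

/-- `D` is the principal minor `Δ_μ`: the regular function on `G` such that
`Δ_μ(u⁻ t u⁺) = μ(t)` for `u^± ∈ U^±` and `t ∈ T`. -/
def IsPrincipalMinor {n : ℕ} (μ : Weight n) (D : G n → ℂ) : Prop :=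
  IsRegular D ∧ ∀ u ∈ Uminus n, ∀ v ∈ Uplus n, ∀ t : Fin n → ℂˣ,
    D (u * torus t * v) = ((∏ i, t i ^ μ i : ℂˣ) : ℂ)

/-- `D` is the generalized minor `Δ_{γ,δ}`, where `γ = uμ` and `δ = vμ` with `u`, `v` in the Weyl
group: `Δ_{γ,δ}(g) = Δ_μ(ū⁻¹ g v̄)`. -/
def IsGeneralizedMinor {n : ℕ} (μ γ δ : Weight n) (D : G n → ℂ) : Prop :=
  ∃ D₀ : G n → ℂ, IsPrincipalMinor μ D₀ ∧
    ∃ a b : List (Fin n), IsReducedWord a ∧ IsReducedWord b ∧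
      wordProd a μ = γ ∧ wordProd b μ = δ ∧
      ∀ g, D g = D₀ ((wordLift a)⁻¹ * g * wordLift b)

/-! ### The map `Θ⁻` for the word `(1 2 ⋯ n)^n`

The variables are `c i j = c_i^{(j)}`, and `j` runs over all of `ℤ`; only those with `1 ≤ j ≤ n`
occur in `Θ⁻`. -/

/-- `𝐲_i(c) = y_i(c) α_i^∨(c⁻¹)`. -/
noncomputable def yBold {n : ℕ} (i : Fin n) (c : ℂˣ) : G n :=
  ySub i (c : ℂ) * alphaCheck i c⁻¹

/-- `Θ⁻(c) = (𝐲_1(c_1^{(1)}) ⋯ 𝐲_n(c_n^{(1)})) ⋯ (𝐲_1(c_1^{(n)}) ⋯ 𝐲_n(c_n^{(n)}))`. -/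
noncomputable def Theta {n : ℕ} (c : Fin n → ℤ → ℂˣ) : G n :=
  (List.ofFn fun j : Fin n =>
    (List.ofFn fun i : Fin n => yBold i (c i (((j : ℕ) : ℤ) + 1))).prod).prod

/-! ### Triangles -/

/-- Triangular arrays with `n` rows; `t l k` is the entry `j_{k+1}^{(l+1)}`, that is, the entry with
index `k + 1` in row `l + 1`, which has `l + 1` entries. -/
abbrev TriArray (n : ℕ) : Type := (l : Fin n) → Fin ((l : ℕ) + 1) → Fin (n + 2)

/-- The conditions `1 ≤ j_k^{(l)} ≤ n + 1` for `1 ≤ k ≤ l ≤ n`, and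
`j_k^{(l+1)} ≤ j_k^{(l)} < j_{k+1}^{(l+1)}` for `1 ≤ k ≤ l < n`. -/
def IsTriangle {n : ℕ} (t : TriArray n) : Prop :=
  (∀ (l : Fin n) (k : Fin ((l : ℕ) + 1)), 1 ≤ (t l k : ℕ) ∧ (t l k : ℕ) ≤ n + 1) ∧
  ∀ (l : Fin n) (h : (l : ℕ) + 1 < n) (k : Fin ((l : ℕ) + 1)),
    t ⟨l + 1, h⟩ k.castSucc ≤ t l k ∧ t l k < t ⟨l + 1, h⟩ k.succ

instance {n : ℕ} : DecidablePred (IsTriangle (n := n)) := fun t => by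
  unfold IsTriangle; infer_instance

/-- The set of triangles. -/
def triangles (n : ℕ) : Finset (TriArray n) := Finset.univ.filter IsTriangle

/-- The triangle `δ_l`, with `j_k^{(l)} = k` for all `k`, `l`. -/
def lowestTriangle (n : ℕ) : TriArray n := fun l k => ⟨(k : ℕ) + 1, by omega⟩

/-- Row `r = l + 1` of `t` is `(r + 1, r, …, s + 1, s - 1, …, 2, 1)` (written from the last entry
to the first): its entry with index `m` is `m` for `m < s`, and `m + 1` for `m ≥ s`. -/
def IsRowLabel {n : ℕ} (t : TriArray n) (l : Fin n) (s : ℕ) : Prop :=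
  1 ≤ s ∧ s ≤ (l : ℕ) + 2 ∧
    ∀ k : Fin ((l : ℕ) + 1), (t l k : ℕ) = if (k : ℕ) + 1 < s then (k : ℕ) + 1 else (k : ℕ) + 2

/-- The number `s` with `IsRowLabel t l s`; each row of a triangle has exactly one. -/
noncomputable def rowLabel {n : ℕ} (t : TriArray n) (l : Fin n) : ℕ := sInf {s | IsRowLabel t l s}

/-- The label `(s_1, …, s_n)` of a triangle, extended by `s_0 = 1`. -/
noncomputable def label₀ {n : ℕ} (t : TriArray n) (r : ℕ) : ℕ :=
  if h : 1 ≤ r ∧ r ≤ n then rowLabel t ⟨r - 1, by omega⟩ else 1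

/-- The label `(s_1, …, s_n)` of a triangle, extended by `s_0 = 1` and `s_{n+1} = s_{n-1} + 1`. -/
noncomputable def label {n : ℕ} (t : TriArray n) (r : ℕ) : ℕ :=
  if r = n + 1 then label₀ t (n - 1) + 1 else label₀ t r

/-- Row `r` is of type I. -/
def IsTypeI {n : ℕ} (t : TriArray n) (r : ℕ) : Prop :=
  label t (r + 1) = label t r + 1 ∧ label t r = label t (r - 1)

/-- Row `r` is of type IV. -/
def IsTypeIV {n : ℕ} (t : TriArray n) (r : ℕ) : Prop :=
  label t (r + 1) = label t r ∧ label t r = label t (r - 1) + 1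

open Classical in
/-- The Laurent monomial `m(δ)`, as a function of the variables `c i j = c_i^{(j)}`: a row `i` of
type I contributes `c_i^{(s_i)}`, one of type IV contributes `(c_i^{(s_i)})⁻¹`, and the rows of the
other two types contribute `1`. -/
noncomputable def mono {n : ℕ} (t : TriArray n) (c : Fin n → ℤ → ℂˣ) : ℂˣ :=
  ∏ i : Fin n,
    if IsTypeI t ((i : ℕ) + 1) then c i (label t ((i : ℕ) + 1))
    else if IsTypeIV t ((i : ℕ) + 1) then (c i (label t ((i : ℕ) + 1)))⁻¹
    else 1

/-- The monomial obtained from `m(δ)` by the substitution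
`c_i^{(j)} ↦ (c_i^{(n - j + 1)})⁻¹`. -/
noncomputable def monoBar {n : ℕ} (t : TriArray n) (c : Fin n → ℤ → ℂˣ) : ℂˣ :=
  mono t fun i j => (c i ((n : ℤ) - j + 1))⁻¹

end TypeB

open TypeB

/-!
The spin representation is minuscule: its weight spaces are lines, spanned by the sign vectors, and
`h_i` has eigenvalues in `{-1, 0, 1}`. The entry of a matrix of `G` at the highest weight vector is
`Λ_n(t)` at `u⁻ t u⁺`, and the big cell `U⁻ T U⁺` is dense, so this entry is the principal minor
`Δ_{Λ_n}`. Since `s̄_i` maps a basis vector on which `h_i` has eigenvalue `1` to a basis vector with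
coefficient `1`, and since `w₀ = -1`, the generalized minor is the matrix entry at row
`(-, …, -, +)` and column `(+, …, +)`.

Read the rows of a product of blocks `𝐲_1 ⋯ 𝐲_n` as positions of minus signs. One block sweeps the
sites from left to right; its factor `𝐲_i` either leaves the signs in place or moves a minus sign
from site `i` to site `i + 1` (out of the system, if `i = n`), so that each block removes at most
one minus sign. The `n` blocks have to remove `n - 1` of them, hence the states that occur have
all but one of their minus signs packed to the left, and the entry satisfies a recursion in the
number of blocks. It is solved by the sum over the proper subsets `P` of `{1, …, n}`, which
correspond to the triangles other than `δ_l`: `P` is the set of places where the label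
`(s_0, …, s_n)` increases.
-/

namespace TypeB

variable {n : ℕ}

/-! ### Orthonormal coordinates of weights -/

/-- Twice the coordinates of a weight in the orthonormal basis for which `α_i` is the difference of
two consecutive basis vectors (`i < n`) and `α_n` is the last one; the doubling keeps the
coordinates integral. -/
def coord : Weight n →ₗ[ℤ] (Fin n → ℤ) :=
  LinearMap.pi fun a =>
    ∑ k ∈ Finset.Ici a, (if (k : ℕ) + 1 < n then 2 else 1 : ℤ) • LinearMap.proj k

theorem coord_apply (wt : Weight n) (a : Fin n) :
    coord wt a = ∑ k ∈ Finset.Ici a, (if (k : ℕ) + 1 < n then 2 else 1) * wt k := by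
  simp only [coord, LinearMap.pi_apply, LinearMap.coe_sum, Finset.sum_apply, LinearMap.smul_apply,
    LinearMap.proj_apply, smul_eq_mul]

theorem coord_of_not_lt {a : Fin n} (h : ¬ (a : ℕ) + 1 < n) (wt : Weight n) :
    coord wt a = wt a := by
  have hIci : Finset.Ici a = {a} := by
    ext k
    simp only [Finset.mem_Ici, Finset.mem_singleton, Fin.le_def, Fin.ext_iff]
    omega
  rw [coord_apply, hIci, Finset.sum_singleton, if_neg h, one_mul]

theorem coord_of_lt {a : Fin n} (h : (a : ℕ) + 1 < n) (wt : Weight n) :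
    2 * wt a = coord wt a - coord wt ⟨a + 1, h⟩ := by
  have hIoi : Finset.Ioi a = Finset.Ici (⟨a + 1, h⟩ : Fin n) := by
    ext k
    simp only [Finset.mem_Ioi, Finset.mem_Ici, Fin.lt_def, Fin.le_def]
    omega
  rw [coord_apply, coord_apply, ← Finset.Ioi_insert, Finset.sum_insert (by simp), if_pos h, hIoi,
    add_sub_cancel_right]

theorem coord_injective : Function.Injective (coord (n := n)) := by
  intro v w h
  funext a
  by_cases ha : (a : ℕ) + 1 < n
  · have hv := coord_of_lt ha v
    have hw := coord_of_lt ha w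
    rw [h] at hv
    omega
  · rw [← coord_of_not_lt ha v, ← coord_of_not_lt ha w, h]

theorem coord_eq_of_forall {wt : Weight n} {y : Fin n → ℤ}
    (hlt : ∀ (a : Fin n) (ha : (a : ℕ) + 1 < n), 2 * wt a = y a - y ⟨a + 1, ha⟩)
    (hlast : ∀ a : Fin n, ¬ (a : ℕ) + 1 < n → wt a = y a) : coord wt = y := by
  have descend (m : ℕ) : ∀ a : Fin n, (a : ℕ) + m + 1 = n → coord wt a = y a := by
    induction m with
    | zero => intro a ha; rw [coord_of_not_lt (by omega), hlast a (by omega)]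
    | succ m ih =>
      intro a ha
      have hy := hlt a (by omega)
      have hcoord := coord_of_lt (a := a) (by omega) wt
      have hnext := ih ⟨a + 1, by omega⟩ (by simp only; omega)
      omega
  exact funext fun a => descend (n - 1 - a) a (by omega)

theorem coord_simpleRoot (i a : Fin n) :
    coord (simpleRoot i) a = if a = i then 2 else if (a : ℕ) = i + 1 then -2 else 0 := by
  refine congrFun (coord_eq_of_forall
    (y := fun a => if a = i then 2 else if (a : ℕ) = i + 1 then -2 else 0) ?_ ?_) a <;>
  · intro a ha
    simp only [simpleRoot, cartan, Fin.ext_iff]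
    split_ifs <;> omega

/-! ### The spin representation is minuscule -/

/-- The sign `±1` of a coordinate of a basis vector of the spin representation. -/
def sgn (x : Bool) : ℤ := if x then 1 else -1

/-- The weight of a basis vector of the spin representation. -/
def spinWeight (a : Spin n) : Weight n := fun i => hval i a

theorem coord_spinWeight (a : Spin n) : coord (spinWeight a) = fun i => sgn (a i) := by
  refine coord_eq_of_forall (fun i hi => ?_) fun i hi => ?_
  · simp only [spinWeight, hval, dif_pos hi, sgn]
    cases a i <;> cases a ⟨i + 1, hi⟩ <;> simp
  · simp only [spinWeight, hval, dif_neg hi, sgn]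

theorem sgn_injective : Function.Injective sgn := by decide

theorem spinWeight_injective : Function.Injective (spinWeight (n := n)) := by
  intro a b h
  have hcoord := congrArg coord h
  rw [coord_spinWeight, coord_spinWeight] at hcoord
  exact funext fun i => sgn_injective (congrFun hcoord i)

theorem spinWeight_compl (a : Spin n) : spinWeight aᶜ = -spinWeight a := by
  apply coord_injective
  rw [map_neg, coord_spinWeight, coord_spinWeight]
  funext i
  simp only [Pi.compl_apply, Pi.neg_apply]
  cases a i <;> rfl

theorem isSome_lower_iff {i : Fin n} {a : Spin n} : (lower i a).isSome ↔ hval i a = 1 := by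
  unfold lower hval
  split_ifs <;> simp_all

theorem spinWeight_lower {i : Fin n} {a b : Spin n} (h : lower i a = some b) :
    spinWeight b = spinWeight a - simpleRoot i := by
  apply coord_injective
  rw [map_sub, coord_spinWeight, coord_spinWeight]
  funext k
  rw [Pi.sub_apply, coord_simpleRoot]
  unfold lower at h
  split_ifs at h with hi hai hai <;> cases h
  · by_cases hk : k = i
    · subst hk
      simp [sgn, hai.1, Fin.ext_iff]
    · by_cases hk' : (k : ℕ) = i + 1
      · obtain rfl : k = ⟨i + 1, hi⟩ := Fin.ext hk'
        simp [sgn, hai.2, Fin.ext_iff]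
      · simp [hk, hk', Fin.ext_iff]
  · by_cases hk : k = i
    · subst hk
      simp [sgn, hai]
    · simp [hk, show (k : ℕ) ≠ i + 1 by omega]

theorem hval_sub_cartan_of_lower {i : Fin n} {a b : Spin n} (h : lower i a = some b) (j : Fin n) :
    hval j b = hval j a - cartan n j i :=
  congrFun (spinWeight_lower h) j

theorem sgn_apply_of_spinWeight_eq_sub {i : Fin n} {a b : Spin n}
    (h : spinWeight b = spinWeight a - simpleRoot i) (k : Fin n) :
    sgn (b k) = sgn (a k) - if k = i then 2 else if (k : ℕ) = i + 1 then -2 else 0 := by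
  have hcoord := congrFun (congrArg coord h) k
  rwa [map_sub, Pi.sub_apply, coord_spinWeight, coord_spinWeight, coord_simpleRoot] at hcoord

theorem isSome_lower_of_spinWeight_eq_sub {i : Fin n} {a b : Spin n}
    (h : spinWeight b = spinWeight a - simpleRoot i) : (lower i a).isSome := by
  have hsgn := sgn_apply_of_spinWeight_eq_sub h
  have hi := hsgn i
  unfold lower
  split_ifs with hlt ha ha
  · rfl
  · have hnext := hsgn ⟨i + 1, hlt⟩
    refine (ha ?_).elim
    revert hi hnext
    simp only [Fin.ext_iff, sgn]
    cases a i <;> cases a ⟨i + 1, hlt⟩ <;> cases b i <;> cases b ⟨i + 1, hlt⟩ <;> simp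
  · rfl
  · refine (ha ?_).elim
    revert hi
    cases a i <;> cases b i <;> simp [sgn]

theorem lower_eq_some_iff {i : Fin n} {a b : Spin n} :
    lower i a = some b ↔ spinWeight b = spinWeight a - simpleRoot i := by
  refine ⟨spinWeight_lower, fun h => ?_⟩
  obtain ⟨b', hb'⟩ := Option.isSome_iff_exists.1 (isSome_lower_of_spinWeight_eq_sub h)
  rw [hb', spinWeight_injective (h.trans (spinWeight_lower hb').symm)]

theorem raise_compl (i : Fin n) (a : Spin n) : raise i aᶜ = (lower i a).map compl := by
  have update_compl (c : Spin n) (k : Fin n) (x : Bool) :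
      Function.update cᶜ k x = (Function.update c k !x)ᶜ := by
    funext j
    by_cases hj : j = k
    · subst hj
      simp
    · simp [hj]
  unfold raise lower
  simp only [Pi.compl_apply, Bool.compl_eq_bnot, Bool.not_eq_true', Bool.not_eq_false',
    update_compl]
  split_ifs <;> simp_all

theorem raise_eq_some_iff {i : Fin n} {a b : Spin n} :
    raise i a = some b ↔ spinWeight b = spinWeight a + simpleRoot i := by
  have hmap : raise i a = some b ↔ lower i aᶜ = some bᶜ := by
    have h := raise_compl i aᶜ
    rw [compl_compl] at h
    rw [h, ← (Option.map_injective compl_injective).eq_iff (a := lower i aᶜ), Option.map_some,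
      compl_compl]
  rw [hmap, lower_eq_some_iff, spinWeight_compl, spinWeight_compl, ← neg_add', neg_inj]

theorem raise_eq_some_iff_lower {i : Fin n} {a b : Spin n} :
    raise i a = some b ↔ lower i b = some a := by
  rw [raise_eq_some_iff, lower_eq_some_iff, eq_sub_iff_add_eq, eq_comm]

theorem isSome_raise_iff {i : Fin n} {a : Spin n} : (raise i a).isSome ↔ hval i a = -1 := by
  have hcompl : hval i aᶜ = -hval i a := congrFun (spinWeight_compl a) i
  rw [← compl_compl a, raise_compl, Option.isSome_map, isSome_lower_iff, compl_compl, hcompl,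
    neg_eq_iff_eq_neg]

theorem hval_eq_or (i : Fin n) (a : Spin n) : hval i a = -1 ∨ hval i a = 0 ∨ hval i a = 1 := by
  unfold hval
  split_ifs <;> simp

theorem cartan_nonpos {i j : Fin n} (hij : i ≠ j) : cartan n i j ≤ 0 := by
  unfold cartan
  split_ifs <;> simp_all

/-- The partial bijection of the basis vectors given by `f_i`, with `e_i` as its inverse. -/
def lowerPEquiv (i : Fin n) : Spin n ≃. Spin n where
  toFun := lower i
  invFun := raise i
  inv _ _ := raise_eq_some_iff_lower

theorem eMat_eq_toMatrix (i : Fin n) : eMat i = (lowerPEquiv i).toMatrix := by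
  ext a b
  exact if_congr raise_eq_some_iff_lower rfl rfl

theorem fMat_eq_toMatrix (i : Fin n) : fMat i = (lowerPEquiv i).symm.toMatrix := by
  ext a b
  exact if_congr raise_eq_some_iff_lower.symm rfl rfl

theorem transpose_eMat (i : Fin n) : (eMat i).transpose = fMat i := by
  rw [eMat_eq_toMatrix, fMat_eq_toMatrix, PEquiv.toMatrix_symm]

theorem toMatrix_ofSet {α R : Type*} [DecidableEq α] [Zero R] [One R] (s : Set α)
    [DecidablePred (· ∈ s)] :
    (PEquiv.ofSet s).toMatrix = Matrix.diagonal fun a => if a ∈ s then (1 : R) else 0 := by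
  ext a b
  simp only [PEquiv.toMatrix_apply, PEquiv.mem_ofSet_iff, Matrix.diagonal_apply, ← ite_and]
  exact if_congr (by constructor <;> (rintro ⟨rfl, h⟩; exact ⟨rfl, h⟩)) rfl rfl

theorem eMat_mul_fMat (i : Fin n) :
    eMat i * fMat i = Matrix.diagonal fun a => if hval i a = 1 then 1 else 0 := by
  rw [eMat_eq_toMatrix, fMat_eq_toMatrix, ← PEquiv.toMatrix_trans, PEquiv.self_trans_symm]
  exact (toMatrix_ofSet _).trans
    (congrArg _ (funext fun a => if_congr isSome_lower_iff rfl rfl))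

theorem fMat_mul_eMat (i : Fin n) :
    fMat i * eMat i = Matrix.diagonal fun a => if hval i a = -1 then 1 else 0 := by
  rw [eMat_eq_toMatrix, fMat_eq_toMatrix, ← PEquiv.toMatrix_trans, PEquiv.symm_trans_self]
  exact (toMatrix_ofSet _).trans
    (congrArg _ (funext fun a => if_congr isSome_raise_iff rfl rfl))

theorem eMat_mul_fMat_mul_eMat (i : Fin n) : eMat i * fMat i * eMat i = eMat i := by
  ext a b
  rw [eMat_mul_fMat, Matrix.diagonal_mul, ite_mul, one_mul, zero_mul, ite_eq_left_iff]
  intro ha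
  refine (if_neg fun hb => ha (isSome_lower_iff.1 ?_)).symm
  rw [raise_eq_some_iff_lower.1 hb, Option.isSome_some]

theorem fMat_mul_eMat_mul_fMat (i : Fin n) : fMat i * eMat i * fMat i = fMat i := by
  simpa [transpose_eMat, ← transpose_eMat, mul_assoc]
    using congrArg Matrix.transpose (eMat_mul_fMat_mul_eMat i)

theorem lowerPEquiv_trans_symm_comm {i j : Fin n} (hij : i ≠ j) :
    (lowerPEquiv i).trans (lowerPEquiv j).symm = (lowerPEquiv j).symm.trans (lowerPEquiv i) := by
  refine PEquiv.ext fun a => Option.ext fun c => ?_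
  rw [PEquiv.trans_eq_some, PEquiv.trans_eq_some]
  change (∃ b, lower i a = some b ∧ raise j b = some c) ↔
    ∃ d, raise j a = some d ∧ lower i d = some c
  constructor
  · rintro ⟨b, hab, hbc⟩
    have ha : hval j a = -1 := by
      have hb := isSome_raise_iff.1 (Option.isSome_of_mem hbc)
      have hstep := hval_sub_cartan_of_lower hab j
      have := cartan_nonpos hij.symm
      rcases hval_eq_or j a with h | h | h <;> omega
    obtain ⟨d, hd⟩ := Option.isSome_iff_exists.1 (isSome_raise_iff.2 ha)
    refine ⟨d, hd, ?_⟩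
    rw [lower_eq_some_iff] at hab ⊢
    rw [raise_eq_some_iff] at hbc hd
    rw [hbc, hab, hd]
    abel
  · rintro ⟨d, had, hdc⟩
    have ha : hval i a = 1 := by
      have hd := isSome_lower_iff.1 (Option.isSome_of_mem hdc)
      have hstep := hval_sub_cartan_of_lower (raise_eq_some_iff_lower.1 had) i
      have := cartan_nonpos hij
      rcases hval_eq_or i a with h | h | h <;> omega
    obtain ⟨b, hb⟩ := Option.isSome_iff_exists.1 (isSome_lower_iff.2 ha)
    refine ⟨b, hb, ?_⟩
    rw [lower_eq_some_iff] at hdc hb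
    rw [raise_eq_some_iff] at had ⊢
    rw [hdc, had, hb]
    abel

theorem eMat_mul_fMat_of_ne {i j : Fin n} (hij : i ≠ j) : eMat i * fMat j = fMat j * eMat i := by
  rw [eMat_eq_toMatrix, fMat_eq_toMatrix, ← PEquiv.toMatrix_trans, ← PEquiv.toMatrix_trans,
    lowerPEquiv_trans_symm_comm hij]

/-! ### Relations between the generators of `G` -/

/-- The matrix of a group element in the spin representation. -/
def mat : G n →* Matrix (Spin n) (Spin n) ℂ :=
  (Units.coeHom _).comp (G n).subtype

theorem mat_injective : Function.Injective (mat (n := n)) :=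
  Units.val_injective.comp Subtype.val_injective

theorem exp_smul_of_mul_self_eq_zero {K A : Type*} [CommSemiring K] [Ring A] [Algebra K A]
    [Module ℚ A] {e : A} (he : e * e = 0) (t : K) : IsNilpotent.exp (t • e) = 1 + t • e := by
  have hsq : (t • e) ^ 2 = 0 := by rw [sq, smul_mul_smul_comm, he, smul_zero]
  simp [IsNilpotent.exp_eq_sum hsq, Finset.sum_range_succ]

theorem mat_xSub (i : Fin n) (t : ℂ) : mat (xSub i t) = 1 + t • eMat i :=
  exp_smul_of_mul_self_eq_zero (eMat_mul_self i) t

theorem mat_ySub (i : Fin n) (t : ℂ) : mat (ySub i t) = 1 + t • fMat i :=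
  exp_smul_of_mul_self_eq_zero (fMat_mul_self i) t

theorem mat_alphaCheck (i : Fin n) (c : ℂˣ) :
    mat (alphaCheck i c) = Matrix.diagonal fun a => (c : ℂ) ^ hval i a :=
  congrArg Matrix.diagonal (funext fun _ => Units.val_zpow_eq_zpow_val _ _)

theorem mat_torus (t : Fin n → ℂˣ) :
    mat (torus t) = Matrix.diagonal fun a => ∏ i, (t i : ℂ) ^ hval i a := by
  rw [torus, map_list_prod, List.map_ofFn]
  have hdiag : ⇑mat ∘ (fun i => alphaCheck i (t i)) =
      Matrix.diagonalRingHom (Spin n) ℂ ∘ fun i a => (t i : ℂ) ^ hval i a :=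
    funext fun i => mat_alphaCheck i (t i)
  rw [hdiag, ← List.map_ofFn, ← map_list_prod, List.prod_ofFn]
  exact congrArg _ (funext fun a => Finset.prod_apply _ _ _)

theorem transpose_mat_xSub (i : Fin n) (t : ℂ) : (mat (xSub i t)).transpose = mat (ySub i t) := by
  rw [mat_xSub, mat_ySub, Matrix.transpose_add, Matrix.transpose_one, Matrix.transpose_smul,
    transpose_eMat]

theorem transpose_mat_ySub (i : Fin n) (t : ℂ) : (mat (ySub i t)).transpose = mat (xSub i t) := by
  rw [← transpose_mat_xSub, Matrix.transpose_transpose]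

theorem transpose_mat_torus (t : Fin n → ℂˣ) : (mat (torus t)).transpose = mat (torus t) := by
  rw [mat_torus, Matrix.diagonal_transpose]

theorem xSub_add (i : Fin n) (a b : ℂ) : xSub i (a + b) = xSub i a * xSub i b := by
  apply mat_injective
  rw [map_mul, mat_xSub, mat_xSub, mat_xSub]
  simp only [mul_add, add_mul, mul_one, one_mul, smul_mul_smul_comm, eMat_mul_self, smul_zero,
    add_zero, add_smul, add_assoc]

theorem xSub_zero (i : Fin n) : xSub i 0 = 1 := by
  apply mat_injective
  rw [mat_xSub, zero_smul, add_zero, map_one]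

theorem xSub_inv (i : Fin n) (a : ℂ) : (xSub i a)⁻¹ = xSub i (-a) := by
  rw [inv_eq_iff_mul_eq_one, ← xSub_add, add_neg_cancel, xSub_zero]

theorem eq_of_transpose_mat_eq {g h : G n} (hgh : (mat g).transpose = (mat h).transpose) : g = h :=
  mat_injective (Matrix.transpose_injective hgh)

theorem ySub_inv (i : Fin n) (a : ℂ) : (ySub i a)⁻¹ = ySub i (-a) := by
  rw [inv_eq_iff_mul_eq_one]
  apply eq_of_transpose_mat_eq
  rw [map_mul, Matrix.transpose_mul, transpose_mat_ySub, transpose_mat_ySub, ← map_mul, ← xSub_add,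
    neg_add_cancel, xSub_zero, map_one, Matrix.transpose_one]

theorem xSub_mul_ySub_of_ne {i j : Fin n} (hij : i ≠ j) (a b : ℂ) :
    xSub i a * ySub j b = ySub j b * xSub i a := by
  apply mat_injective
  have hcomm : Commute (eMat i) (fMat j) := eMat_mul_fMat_of_ne hij
  rw [map_mul, map_mul, mat_xSub, mat_ySub]
  exact (Commute.one_left _).add_left
    ((Commute.one_right _).add_right ((hcomm.smul_left a).smul_right b))

theorem one_add_smul_mul_one_add_smul {K A : Type*} [Field K] [Ring A] [Algebra K A] {e f : A}
    (he : e * e = 0) (hf : f * f = 0) (hefe : e * f * e = e) (hfef : f * e * f = f) {a b u : K}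
    (hu : u = 1 + a * b) (hu₀ : u ≠ 0) :
    (1 + a • e) * (1 + b • f) =
      (1 + (b / u) • f) * (1 + (u - 1) • (e * f) + (u⁻¹ - 1) • (f * e)) * (1 + (a / u) • e) := by
  set h := 1 + (u - 1) • (e * f) + (u⁻¹ - 1) • (f * e) with h_def
  have hfh : f * h = u • f := by
    rw [h_def, mul_add, mul_add, mul_one, mul_smul_comm, mul_smul_comm, ← mul_assoc, ← mul_assoc,
      hfef, hf, zero_mul]
    module
  have hhe : h * e = u • e := by
    rw [h_def, add_mul, add_mul, one_mul, smul_mul_assoc, smul_mul_assoc, hefe, mul_assoc, he,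
      mul_zero]
    module
  have hfirst : (1 + (b / u) • f) * h = h + b • f := by
    rw [add_mul, one_mul, smul_mul_assoc, hfh, smul_smul, div_mul_cancel₀ _ hu₀]
  have hsecond : h * (1 + (a / u) • e) = h + a • e := by
    rw [mul_add, mul_one, mul_smul_comm, hhe, smul_smul, div_mul_cancel₀ _ hu₀]
  have hef : u - 1 = a * b := by rw [hu]; ring
  have hfe : u⁻¹ - 1 = -(b * (a / u)) := by field_simp; rw [hu]; ring
  rw [hfirst, add_mul h, hsecond, h_def, hef, hfe]
  simp only [mul_add, add_mul, one_mul, mul_one, smul_mul_smul_comm]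
  module

theorem mat_alphaCheck_eq_sub (i : Fin n) (c : ℂˣ) : mat (alphaCheck i c) =
    1 + ((c : ℂ) - 1) • (eMat i * fMat i) + ((c : ℂ)⁻¹ - 1) • (fMat i * eMat i) := by
  rw [mat_alphaCheck, eMat_mul_fMat, fMat_mul_eMat, ← Matrix.diagonal_one, ← Matrix.diagonal_smul,
    ← Matrix.diagonal_smul, Matrix.diagonal_add, Matrix.diagonal_add]
  congr 1
  funext a
  rcases hval_eq_or i a with h | h | h <;> simp [h]

theorem xSub_mul_ySub (i : Fin n) (a b : ℂ) (u : ℂˣ) (hu : (u : ℂ) = 1 + a * b) :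
    xSub i a * ySub i b = ySub i (b / u) * alphaCheck i u * xSub i (a / u) := by
  apply mat_injective
  simp only [map_mul, mat_xSub, mat_ySub, mat_alphaCheck_eq_sub]
  exact one_add_smul_mul_one_add_smul (eMat_mul_self i) (fMat_mul_self i)
    (eMat_mul_fMat_mul_eMat i) (fMat_mul_eMat_mul_fMat i) hu u.ne_zero

theorem torus_mul (s t : Fin n → ℂˣ) : torus s * torus t = torus (s * t) := by
  apply mat_injective
  rw [map_mul, mat_torus, mat_torus, mat_torus, Matrix.diagonal_mul_diagonal]
  simp only [Pi.mul_apply, Units.val_mul, mul_zpow, Finset.prod_mul_distrib]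

theorem torus_one : torus (1 : Fin n → ℂˣ) = 1 := by
  apply mat_injective
  simp [mat_torus]

theorem alphaCheck_eq_torus (i : Fin n) (c : ℂˣ) : alphaCheck i c = torus (Pi.mulSingle i c) := by
  apply mat_injective
  rw [mat_torus, mat_alphaCheck]
  congr 1
  funext a
  rw [Finset.prod_eq_single i (fun j _ hj => by simp [hj]) (by simp), Pi.mulSingle_eq_same]

/-- The value of the simple root `α_i` on a torus element. -/
def rootVal (i : Fin n) (t : Fin n → ℂˣ) : ℂˣ := ∏ k, t k ^ simpleRoot i k

theorem torus_mul_xSub (i : Fin n) (t : Fin n → ℂˣ) (b : ℂ) :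
    torus t * xSub i b = xSub i (rootVal i t * b) * torus t := by
  apply mat_injective
  rw [map_mul, map_mul, mat_xSub, mat_xSub, mul_add, add_mul, mul_one, one_mul]
  congr 1
  rw [mat_torus]
  ext a c
  rw [Matrix.diagonal_mul, Matrix.mul_diagonal, Matrix.smul_apply, Matrix.smul_apply]
  by_cases h : raise i c = some a
  · have hval_add (k : Fin n) : hval k a = simpleRoot i k + hval k c := by
      rw [add_comm]
      exact congrFun (raise_eq_some_iff.1 h) k
    have hval_prod : ∏ k, (t k : ℂ) ^ hval k a = rootVal i t * ∏ k, (t k : ℂ) ^ hval k c := by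
      simp only [hval_add, zpow_add₀ (t _).ne_zero, Finset.prod_mul_distrib, rootVal,
        Units.coe_prod, Units.val_zpow_eq_zpow_val]
    rw [hval_prod, smul_eq_mul, smul_eq_mul]
    ring
  · simp [eMat, h]

theorem torus_mul_ySub (i : Fin n) (t : Fin n → ℂˣ) (b : ℂ) :
    torus t * ySub i b = ySub i ((rootVal i t)⁻¹ * b) * torus t := by
  apply eq_of_transpose_mat_eq
  rw [map_mul, map_mul, Matrix.transpose_mul, Matrix.transpose_mul, transpose_mat_ySub,
    transpose_mat_ySub, transpose_mat_torus, ← map_mul, ← map_mul, torus_mul_xSub,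
    Units.mul_inv_cancel_left]

theorem xSub_mem (i : Fin n) (a : ℂ) : xSub i a ∈ Uplus n := Subgroup.subset_closure ⟨i, a, rfl⟩

theorem ySub_mem (i : Fin n) (a : ℂ) : ySub i a ∈ Uminus n := Subgroup.subset_closure ⟨i, a, rfl⟩

/-! ### The big cell and the principal minor -/

theorem closure_induction_of_inv_mem {Γ : Type*} [Group Γ] {s : Set Γ}
    (hs : ∀ g ∈ s, g⁻¹ ∈ s) {p : (g : Γ) → g ∈ Subgroup.closure s → Prop} (one : p 1 (one_mem _))
    (mul_left : ∀ (g) (hg : g ∈ s) (h) (hh : h ∈ Subgroup.closure s),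
      p h hh → p (g * h) (mul_mem (Subgroup.subset_closure hg) hh))
    {g : Γ} (hg : g ∈ Subgroup.closure s) : p g hg := by
  induction hg using Subgroup.closure_induction_left with
  | one => exact one
  | mul_left x hx y hy ih => exact mul_left x hx y hy ih
  | inv_mul_cancel x hx y hy ih => exact mul_left x⁻¹ (hs x hx) y hy ih

theorem Uplus_induction {p : G n → Prop} (one : p 1)
    (xSub_mul : ∀ i a g, p g → p (xSub i a * g)) {g : G n} (hg : g ∈ Uplus n) : p g := by
  refine closure_induction_of_inv_mem (p := fun g _ => p g) ?_ one ?_ hg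
  · rintro _ ⟨i, a, rfl⟩
    exact ⟨i, -a, xSub_inv i a⟩
  · rintro _ ⟨i, a, rfl⟩ h _ hh
    exact xSub_mul i a h hh

theorem Uminus_induction {p : G n → Prop} (one : p 1)
    (ySub_mul : ∀ i a g, p g → p (ySub i a * g)) {g : G n} (hg : g ∈ Uminus n) : p g := by
  refine closure_induction_of_inv_mem (p := fun g _ => p g) ?_ one ?_ hg
  · rintro _ ⟨i, a, rfl⟩
    exact ⟨i, -a, ySub_inv i a⟩
  · rintro _ ⟨i, a, rfl⟩ h _ hh
    exact ySub_mul i a h hh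

theorem alphaCheck_inv (i : Fin n) (c : ℂˣ) : (alphaCheck i c)⁻¹ = alphaCheck i c⁻¹ := by
  rw [inv_eq_iff_mul_eq_one, alphaCheck_eq_torus, alphaCheck_eq_torus, torus_mul,
    ← Pi.mulSingle_mul, mul_inv_cancel, Pi.mulSingle_one, torus_one]

theorem G_induction {p : G n → Prop} (one : p 1) (xSub_mul : ∀ i a g, p g → p (xSub i a * g))
    (ySub_mul : ∀ i a g, p g → p (ySub i a * g))
    (alphaCheck_mul : ∀ i c g, p g → p (alphaCheck i c * g)) (g : G n) : p g := by
  refine closure_induction_of_inv_mem (p := fun g hg => p ⟨g, hg⟩) ?_ one ?_ g.2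
  · rintro _ ((⟨i, a, rfl⟩ | ⟨i, a, rfl⟩) | ⟨i, c, rfl⟩)
    · exact Or.inl (Or.inl ⟨i, -a, congrArg Subtype.val (xSub_inv i a)⟩)
    · exact Or.inl (Or.inr ⟨i, -a, congrArg Subtype.val (ySub_inv i a)⟩)
    · exact Or.inr ⟨i, c⁻¹, congrArg Subtype.val (alphaCheck_inv i c)⟩
  · rintro _ ((⟨i, a, rfl⟩ | ⟨i, a, rfl⟩) | ⟨i, c, rfl⟩) h hh hp
    · exact xSub_mul i a ⟨h, hh⟩ hp
    · exact ySub_mul i a ⟨h, hh⟩ hp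
    · exact alphaCheck_mul i c ⟨h, hh⟩ hp

/-- The big cell `U⁻ T U⁺` of `G`. -/
def bigCell (n : ℕ) : Set (G n) :=
  {g | ∃ u ∈ Uminus n, ∃ t, ∃ v ∈ Uplus n, g = u * torus t * v}

theorem torus_mul_mem_bigCell (t : Fin n → ℂˣ) {v : G n} (hv : v ∈ Uplus n) :
    torus t * v ∈ bigCell n :=
  ⟨1, one_mem _, t, v, hv, by rw [one_mul]⟩

theorem one_mem_bigCell : (1 : G n) ∈ bigCell n := by
  simpa [torus_one] using torus_mul_mem_bigCell 1 (one_mem (Uplus n))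

theorem ySub_mul_mem_bigCell (i : Fin n) (b : ℂ) {g : G n} (hg : g ∈ bigCell n) :
    ySub i b * g ∈ bigCell n := by
  obtain ⟨u, hu, t, v, hv, rfl⟩ := hg
  exact ⟨ySub i b * u, mul_mem (ySub_mem _ _) hu, t, v, hv, by simp only [mul_assoc]⟩

theorem bigCell_induction {p : G n → Prop} (torus_mul : ∀ t, ∀ v ∈ Uplus n, p (torus t * v))
    (ySub_mul : ∀ i b g, p g → p (ySub i b * g)) {g : G n} (hg : g ∈ bigCell n) : p g := by
  obtain ⟨u, hu, t, v, hv, rfl⟩ := hg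
  rw [mul_assoc]
  refine Uminus_induction (p := fun u => p (u * (torus t * v))) ?_ (fun i b g hg => ?_) hu
  · rw [one_mul]
    exact torus_mul t v hv
  · rw [mul_assoc]
    exact ySub_mul i b _ hg

theorem torus_mul_bigCell (s : Fin n → ℂˣ) {g : G n} (hg : g ∈ bigCell n) :
    torus s * g ∈ bigCell n := by
  refine bigCell_induction (p := fun g => torus s * g ∈ bigCell n) (fun t v hv => ?_)
    (fun i b g hg => ?_) hg
  · rw [← mul_assoc, torus_mul]
    exact torus_mul_mem_bigCell _ hv
  · rw [← mul_assoc, torus_mul_ySub, mul_assoc]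
    exact ySub_mul_mem_bigCell _ _ hg

theorem xSub_mul_torus (i : Fin n) (t : Fin n → ℂˣ) (b : ℂ) :
    xSub i b * torus t = torus t * xSub i ((rootVal i t)⁻¹ * b) := by
  rw [torus_mul_xSub, Units.mul_inv_cancel_left]

theorem eventually_one_add_mul_ne_zero {K : Type*} [Field K] (b : K) :
    ∀ᶠ a in Filter.cofinite, 1 + a * b ≠ 0 := by
  rw [Filter.eventually_cofinite]
  refine (Set.finite_singleton (-b)⁻¹).subset fun a ha => ?_
  exact eq_inv_of_mul_eq_one_left (by linear_combination -not_not.1 ha)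

theorem tendsto_div_one_add_mul_cofinite {K : Type*} [Field K] (b : K) :
    Filter.Tendsto (fun a => a / (1 + a * b)) Filter.cofinite Filter.cofinite := by
  refine Filter.Tendsto.cofinite_of_finite_preimage_singleton fun c => ?_
  refine (Set.toFinite {(-b)⁻¹, c / (1 - c * b)}).subset fun a ha => ?_
  obtain hab | hab := eq_or_ne (1 + a * b) 0
  · exact Or.inl (eq_inv_of_mul_eq_one_left (by linear_combination -hab))
  · have hac : a * (1 - c * b) = c := by linear_combination (div_eq_iff hab).1 ha
    refine Or.inr (eq_div_of_mul_eq (fun hcb => hab ?_) hac)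
    rw [hcb, mul_zero] at hac
    simp [← hac] at hcb

/-- In rank one, `x(a) y(b)` lies in the big cell for all but one value of `a`, and its component
in `U⁺` is `x (a / (1 + a b))`, which again runs over all but finitely many values. -/
theorem eventually_xSub_mul_mem_bigCell (i : Fin n) {g : G n} (hg : g ∈ bigCell n) :
    ∀ᶠ a in Filter.cofinite, xSub i a * g ∈ bigCell n := by
  refine bigCell_induction (p := fun g => ∀ᶠ a in Filter.cofinite, xSub i a * g ∈ bigCell n)
    (fun t v hv => ?_) (fun j b g hg => ?_) hg
  · refine Filter.Eventually.of_forall fun a => ?_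
    rw [← mul_assoc, xSub_mul_torus, mul_assoc]
    exact torus_mul_mem_bigCell t (mul_mem (xSub_mem _ _) hv)
  · obtain rfl | hij := eq_or_ne i j
    · filter_upwards [(tendsto_div_one_add_mul_cofinite b).eventually hg,
        eventually_one_add_mul_ne_zero b] with a ha hab
      rw [← mul_assoc, xSub_mul_ySub i a b (Units.mk0 _ hab) rfl, mul_assoc, mul_assoc,
        alphaCheck_eq_torus]
      exact ySub_mul_mem_bigCell i _ (torus_mul_bigCell _ ha)
    · filter_upwards [hg] with a ha
      rw [← mul_assoc, xSub_mul_ySub_of_ne hij, mul_assoc]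
      exact ySub_mul_mem_bigCell j b ha

theorem IsRegular.sub {D D' : G n → ℂ} (hD : IsRegular D) (hD' : IsRegular D') :
    IsRegular (D - D') := by
  obtain ⟨p, hp⟩ := hD
  obtain ⟨q, hq⟩ := hD'
  exact ⟨p - q, fun g => by rw [map_sub, ← hp, ← hq, Pi.sub_apply]⟩

theorem IsRegular.comp_mul_left {D : G n → ℂ} (hD : IsRegular D) (h : G n) :
    IsRegular fun g => D (h * g) := by
  obtain ⟨p, hp⟩ := hD
  refine ⟨MvPolynomial.bind₁ (fun ab => ∑ k, MvPolynomial.C (mat h ab.1 k) *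
    MvPolynomial.X (k, ab.2)) p, fun g => ?_⟩
  refine ((hp _).trans ?_).trans (MvPolynomial.eval₂Hom_bind₁ _ _ _ _).symm
  have hentry (a b : Spin n) : mat (h * g) a b = ∑ k, mat h a k * mat g k b := by
    rw [map_mul, Matrix.mul_apply]
  refine congrArg (fun f => MvPolynomial.eval f p) (funext fun ab => (hentry _ _).trans ?_)
  simp [mat]

theorem IsRegular.exists_polynomial_xSub_mul {D : G n → ℂ} (hD : IsRegular D) (i : Fin n)
    (g : G n) : ∃ q : Polynomial ℂ, ∀ a, D (xSub i a * g) = q.eval a := by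
  obtain ⟨p, hp⟩ := hD
  refine ⟨MvPolynomial.aeval (fun ab => Polynomial.C (mat g ab.1 ab.2) +
    Polynomial.X * Polynomial.C ((eMat i * mat g) ab.1 ab.2)) p, fun a => (hp _).trans ?_⟩
  rw [← Polynomial.coe_evalRingHom, MvPolynomial.aeval_def, MvPolynomial.hom_eval₂,
    MvPolynomial.eval, MvPolynomial.coe_eval₂Hom]
  congr 1
  · ext; simp
  · funext ab
    change mat (xSub i a * g) ab.1 ab.2 = _
    simp [mat_xSub, add_mul, mul_comm a]

theorem IsRegular.xSub_mul_eq_zero {D : G n → ℂ} (hD : IsRegular D)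
    (hzero : ∀ g ∈ bigCell n, D g = 0) (i : Fin n) (a : ℂ) {g : G n} (hg : g ∈ bigCell n) :
    D (xSub i a * g) = 0 := by
  obtain ⟨q, hq⟩ := hD.exists_polynomial_xSub_mul i g
  have hroots : ∃ᶠ b in Filter.cofinite, q.IsRoot b :=
    ((eventually_xSub_mul_mem_bigCell i hg).mono fun b hb =>
      (hq b).symm.trans (hzero _ hb)).frequently
  rw [hq, q.eq_zero_of_infinite_isRoot (Filter.frequently_cofinite_iff_infinite.1 hroots),
    Polynomial.eval_zero]

/-- Density of the big cell: vanishing on it is preserved by translation by each generator. -/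
theorem IsRegular.eq_zero_of_bigCell {D : G n → ℂ} (hD : IsRegular D)
    (hzero : ∀ g ∈ bigCell n, D g = 0) (g : G n) : D g = 0 := by
  revert D
  refine G_induction (p := fun g => ∀ {D : G n → ℂ}, IsRegular D →
    (∀ g ∈ bigCell n, D g = 0) → D g = 0) ?_ ?_ ?_ ?_ g
  · exact fun _ hzero => hzero 1 one_mem_bigCell
  · exact fun i a g ih D hD hzero =>
      ih (hD.comp_mul_left (xSub i a)) fun h hh => hD.xSub_mul_eq_zero hzero i a hh
  · exact fun i b g ih D hD hzero =>
      ih (hD.comp_mul_left (ySub i b)) fun h hh => hzero _ (ySub_mul_mem_bigCell i b hh)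
  · refine fun i c g ih D hD hzero =>
      ih (hD.comp_mul_left (alphaCheck i c)) fun h hh => hzero _ ?_
    rw [alphaCheck_eq_torus]
    exact torus_mul_bigCell _ hh

theorem IsPrincipalMinor.unique {μ : Weight n} {D D' : G n → ℂ} (h : IsPrincipalMinor μ D)
    (h' : IsPrincipalMinor μ D') : D = D' := by
  funext g
  refine sub_eq_zero.1 ((h.1.sub h'.1).eq_zero_of_bigCell ?_ g)
  rintro _ ⟨u, hu, t, v, hv, rfl⟩
  rw [Pi.sub_apply, h.2 u hu v hv, h'.2 u hu v hv, sub_self]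

/-- The highest weight vector of the spin representation. -/
def topSpin (n : ℕ) : Spin n := fun _ => true

theorem spinWeight_topSpin (hn : 1 ≤ n) : spinWeight (topSpin n) = fundWeight (lastIdx n hn) := by
  funext i
  simp only [spinWeight, hval, topSpin, fundWeight, lastIdx, Pi.single_apply, Fin.ext_iff]
  split_ifs <;> first | omega | simp_all

theorem raise_topSpin_ne (i : Fin n) (a : Spin n) : raise i (topSpin n) ≠ some a := by
  have hnone : ¬ (raise i (topSpin n)).isSome := by
    rw [isSome_raise_iff, hval]
    simp only [topSpin]
    split_ifs <;> simp_all
  exact fun h => hnone (h ▸ rfl)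

theorem mat_mul_xSub_topSpin (g : G n) (i : Fin n) (a : ℂ) (b : Spin n) :
    mat (g * xSub i a) b (topSpin n) = mat g b (topSpin n) := by
  rw [map_mul, mat_xSub, mul_add, mul_one, mul_smul_comm, Matrix.add_apply, Matrix.smul_apply]
  simp [Matrix.mul_apply, eMat, raise_topSpin_ne]

theorem mat_mul_topSpin_of_mem_Uplus (g : G n) {v : G n} (hv : v ∈ Uplus n) (b : Spin n) :
    mat (g * v) b (topSpin n) = mat g b (topSpin n) := by
  refine Uplus_induction (p := fun v => ∀ g, mat (g * v) b (topSpin n) = mat g b (topSpin n))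
    (fun g => ?_) (fun i a v hv g => ?_) hv g
  · rw [mul_one]
  · rw [← mul_assoc, hv, mat_mul_xSub_topSpin]

theorem mat_ySub_mul_topSpin (g : G n) (i : Fin n) (a : ℂ) (b : Spin n) :
    mat (ySub i a * g) (topSpin n) b = mat g (topSpin n) b := by
  rw [map_mul, mat_ySub, add_mul, one_mul, smul_mul_assoc, Matrix.add_apply, Matrix.smul_apply]
  simp [Matrix.mul_apply, fMat, ← raise_eq_some_iff_lower, raise_topSpin_ne]

theorem mat_mul_topSpin_of_mem_Uminus {u : G n} (hu : u ∈ Uminus n) (g : G n) (b : Spin n) :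
    mat (u * g) (topSpin n) b = mat g (topSpin n) b := by
  refine Uminus_induction (p := fun u => mat (u * g) (topSpin n) b = mat g (topSpin n) b)
    ?_ (fun i a u hu => ?_) hu
  · rw [one_mul]
  · rw [mul_assoc, mat_ySub_mul_topSpin, hu]

theorem isPrincipalMinor_mat_topSpin :
    IsPrincipalMinor (spinWeight (topSpin n)) fun g => mat g (topSpin n) (topSpin n) := by
  refine ⟨⟨MvPolynomial.X (topSpin n, topSpin n), fun g => by simp [mat]⟩, fun u hu v hv t => ?_⟩
  beta_reduce
  rw [mat_mul_topSpin_of_mem_Uplus _ hv, mat_mul_topSpin_of_mem_Uminus hu, mat_torus,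
    Matrix.diagonal_apply_eq]
  simp [spinWeight]

/-! ### The Weyl group and reduced words -/

theorem simpleReflection_apply (i : Fin n) (wt : Weight n) :
    simpleReflection i wt = wt - wt i • simpleRoot i := rfl

theorem coord_simpleReflection (i : Fin n) (wt : Weight n) (a : Fin n) :
    coord (simpleReflection i wt) a =
      coord wt a - wt i * if a = i then 2 else if (a : ℕ) = i + 1 then -2 else 0 := by
  rw [simpleReflection_apply, map_sub, map_smul, Pi.sub_apply, Pi.smul_apply, coord_simpleRoot,
    smul_eq_mul]

theorem coord_simpleReflection_of_lt {i : Fin n} (h : (i : ℕ) + 1 < n) (wt : Weight n)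
    (a : Fin n) : coord (simpleReflection i wt) a = coord wt (Equiv.swap i ⟨i + 1, h⟩ a) := by
  have hwt := coord_of_lt h wt
  rw [coord_simpleReflection]
  obtain rfl | ha := eq_or_ne a i
  · rw [if_pos rfl, Equiv.swap_apply_left]
    linarith
  obtain rfl | ha' := eq_or_ne a ⟨i + 1, h⟩
  · rw [if_neg ha, if_pos rfl, Equiv.swap_apply_right]
    linarith
  · rw [Equiv.swap_apply_of_ne_of_ne ha ha', if_neg ha, if_neg fun h' => ha' (Fin.ext h'),
      mul_zero, sub_zero]

theorem coord_simpleReflection_of_not_lt {i : Fin n} (h : ¬ (i : ℕ) + 1 < n) (wt : Weight n)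
    (a : Fin n) :
    coord (simpleReflection i wt) a = if a = i then -coord wt a else coord wt a := by
  rw [coord_simpleReflection]
  split_ifs with hai hai'
  · rw [hai, coord_of_not_lt h]
    ring
  · omega
  · rw [mul_zero, sub_zero]

/-- The permutation `w` of the weights acts on their orthonormal coordinates by the permutation `σ`
of the coordinates, followed by the sign changes `η`. -/
def IsSignedPerm (w : Equiv.Perm (Weight n)) (σ : Equiv.Perm (Fin n)) (η : Fin n → ℤˣ) : Prop :=
  ∀ wt a, coord (w wt) a = η a * coord wt (σ a)

theorem exists_isSignedPerm_simpleReflection (i : Fin n) :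
    ∃ σ η, IsSignedPerm (simpleReflection i) σ η := by
  by_cases h : (i : ℕ) + 1 < n
  · exact ⟨Equiv.swap i ⟨i + 1, h⟩, 1, fun wt a => by simp [coord_simpleReflection_of_lt h]⟩
  · refine ⟨1, fun a => if a = i then -1 else 1, fun wt a => ?_⟩
    rw [coord_simpleReflection_of_not_lt h]
    dsimp only
    split_ifs <;> simp

theorem IsSignedPerm.mul {w w' : Equiv.Perm (Weight n)} {σ σ' η η'} (h : IsSignedPerm w σ η)
    (h' : IsSignedPerm w' σ' η') : IsSignedPerm (w * w') (σ' * σ) (η * η' ∘ σ) := fun wt a => by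
  rw [Equiv.Perm.mul_apply, h, h', ← mul_assoc]
  rfl

theorem wordProd_cons (i : Fin n) (a : List (Fin n)) :
    wordProd (i :: a) = simpleReflection i * wordProd a := by
  rw [wordProd, List.map_cons, List.prod_cons, wordProd]

theorem wordProd_append (a b : List (Fin n)) :
    wordProd (a ++ b) = wordProd a * wordProd b := by
  rw [wordProd, List.map_append, List.prod_append, wordProd, wordProd]

theorem wordProd_singleton (i : Fin n) : wordProd [i] = simpleReflection i := List.prod_singleton

theorem exists_isSignedPerm_wordProd (a : List (Fin n)) :
    ∃ σ η, IsSignedPerm (wordProd a) σ η := by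
  induction a with
  | nil => exact ⟨1, 1, fun wt a => by simp [wordProd]⟩
  | cons i a ih =>
    obtain ⟨σ, η, h⟩ := ih
    obtain ⟨σ', η', h'⟩ := exists_isSignedPerm_simpleReflection i
    rw [wordProd_cons]
    exact ⟨_, _, h'.mul h⟩

theorem simpleReflection_mul_self (i : Fin n) :
    (simpleReflection i : Equiv.Perm (Weight n)) * simpleReflection i = 1 :=
  Equiv.ext fun wt => reflection_involutive i wt

/-- The sum `ρ` of the fundamental weights. -/
def rho : Weight n := 1

theorem coord_rho (a : Fin n) : coord (rho : Weight n) a = 2 * ((n : ℤ) - a) - 1 := by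
  refine congrFun (coord_eq_of_forall (y := fun a : Fin n => 2 * ((n : ℤ) - a) - 1) ?_ ?_) a <;>
  · intro a ha
    simp only [rho, Pi.one_apply]
    omega

theorem coord_simpleReflection_rho (i a : Fin n) : coord (simpleReflection i rho) a =
    2 * ((n : ℤ) - a) - 1 - if a = i then 2 else if (a : ℕ) = i + 1 then -2 else 0 := by
  rw [coord_simpleReflection, coord_rho, rho, Pi.one_apply, one_mul]

section Exchange

variable {w : Equiv.Perm (Weight n)} {σ : Equiv.Perm (Fin n)} {η : Fin n → ℤˣ} {i j : Fin n}

theorem IsSignedPerm.apply_pair_of_nonneg_of_neg (hw : IsSignedPerm w σ η)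
    (hi : (i : ℕ) + 1 < n) (hnonneg : 0 ≤ w rho i) (hneg : w (simpleReflection j rho) i < 0) :
    η i = η ⟨i + 1, hi⟩ ∧ ∃ hj : (j : ℕ) + 1 < n,
      (σ i = j ∧ σ ⟨i + 1, hi⟩ = ⟨j + 1, hj⟩ ∨ σ i = ⟨j + 1, hj⟩ ∧ σ ⟨i + 1, hi⟩ = j) := by
  have hrho := coord_of_lt hi (w rho)
  have hrefl := coord_of_lt hi (w (simpleReflection j rho))
  rw [hw, hw, coord_rho, coord_rho] at hrho
  rw [hw, hw, coord_simpleReflection_rho, coord_simpleReflection_rho] at hrefl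
  have hne : σ i ≠ σ ⟨i + 1, hi⟩ := σ.injective.ne (by simp [Fin.ext_iff])
  simp only [Fin.ext_iff, ne_eq] at hrefl hne ⊢
  rcases Int.units_eq_one_or (η i) with h | h <;>
    rcases Int.units_eq_one_or (η ⟨i + 1, hi⟩) with h' | h' <;>
    simp only [h, h', Units.val_one, Units.val_neg] at hrho hrefl <;>
    split_ifs at hrefl <;> first | omega | exact ⟨by rw [h, h'], by omega, by omega⟩

theorem IsSignedPerm.apply_last_of_nonneg_of_neg (hw : IsSignedPerm w σ η)
    (hi : ¬ (i : ℕ) + 1 < n) (hnonneg : 0 ≤ w rho i) (hneg : w (simpleReflection j rho) i < 0) :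
    j = i ∧ σ i = i := by
  have hrho := coord_of_not_lt hi (w rho)
  have hrefl := coord_of_not_lt hi (w (simpleReflection j rho))
  rw [hw, coord_rho] at hrho
  rw [hw, coord_simpleReflection_rho] at hrefl
  simp only [Fin.ext_iff] at hrefl ⊢
  rcases Int.units_eq_one_or (η i) with h | h <;>
    simp only [h, Units.val_one, Units.val_neg] at hrho hrefl <;> split_ifs at hrefl <;> omega

/-- If `w⁻¹ α_i` is positive and `s_j w⁻¹ α_i` is negative, then `w⁻¹ α_i = α_j`. -/
theorem IsSignedPerm.simpleReflection_mul_eq (hw : IsSignedPerm w σ η) (hnonneg : 0 ≤ w rho i)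
    (hneg : w (simpleReflection j rho) i < 0) :
    simpleReflection i * w = w * simpleReflection j := by
  refine Equiv.ext fun wt => coord_injective (funext fun a => ?_)
  rw [Equiv.Perm.mul_apply, Equiv.Perm.mul_apply]
  by_cases hi : (i : ℕ) + 1 < n
  · obtain ⟨hη, hj, hσ⟩ := hw.apply_pair_of_nonneg_of_neg hi hnonneg hneg
    have hswap : Equiv.swap j ⟨j + 1, hj⟩ = Equiv.swap (σ i) (σ ⟨i + 1, hi⟩) := by
      rcases hσ with ⟨h, h'⟩ | ⟨h, h'⟩
      · rw [h, h']
      · rw [h, h', Equiv.swap_comm]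
    have hηswap : η (Equiv.swap i ⟨i + 1, hi⟩ a) = η a := by
      rw [Equiv.swap_apply_def]
      split_ifs with ha ha' <;> simp [*]
    rw [coord_simpleReflection_of_lt hi, hw, hw, coord_simpleReflection_of_lt hj, hswap,
      σ.injective.swap_apply, hηswap]
  · obtain ⟨rfl, hσ⟩ := hw.apply_last_of_nonneg_of_neg hi hnonneg hneg
    have hσiff : σ a = j ↔ a = j := by rw [← σ.injective.eq_iff (a := a), hσ]
    rw [coord_simpleReflection_of_not_lt hi, hw, hw, coord_simpleReflection_of_not_lt hi]
    simp only [hσiff, mul_ite, mul_neg]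

end Exchange

theorem exists_shorter_word (a : List (Fin n)) (i : Fin n) (h : wordProd a rho i < 0) :
    ∃ b : List (Fin n), b.length + 1 = a.length ∧ wordProd (i :: a) = wordProd b := by
  induction a using List.reverseRecOn with
  | nil => simp [wordProd, rho] at h
  | append_singleton v j ih =>
    by_cases hv : wordProd v rho i < 0
    · obtain ⟨b, hb, hprod⟩ := ih hv
      refine ⟨b ++ [j], by simp [hb], ?_⟩
      rw [wordProd_append, ← hprod, ← wordProd_append, List.cons_append]
    · obtain ⟨σ, η, hw⟩ := exists_isSignedPerm_wordProd v
      rw [wordProd_append, wordProd_singleton, Equiv.Perm.mul_apply] at h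
      refine ⟨v, by simp, ?_⟩
      rw [wordProd_cons, wordProd_append, wordProd_singleton, ← mul_assoc,
        hw.simpleReflection_mul_eq (not_lt.1 hv) h, mul_assoc, simpleReflection_mul_self, mul_one]

theorem weylLength_wordProd_le (a : List (Fin n)) : weylLength (wordProd a) ≤ a.length :=
  Nat.sInf_le ⟨a, rfl, rfl⟩

theorem simpleReflection_mem (i : Fin n) : simpleReflection i ∈ weylGroup n :=
  Subgroup.subset_closure ⟨i, rfl⟩

theorem wordProd_mem (a : List (Fin n)) : wordProd a ∈ weylGroup n :=
  list_prod_mem (List.forall_mem_map.2 fun i _ => simpleReflection_mem i)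

theorem exists_wordProd_eq {w : Equiv.Perm (Weight n)} (hw : w ∈ weylGroup n) :
    ∃ a, wordProd a = w := by
  refine closure_induction_of_inv_mem (p := fun w _ => ∃ a, wordProd a = w) ?_ ⟨[], rfl⟩ ?_ hw
  · rintro _ ⟨i, rfl⟩
    exact ⟨i, (inv_eq_of_mul_eq_one_left (simpleReflection_mul_self i)).symm⟩
  · rintro _ ⟨i, rfl⟩ _ _ ⟨a, rfl⟩
    exact ⟨i :: a, wordProd_cons i a⟩

theorem exists_isReducedWord {w : Equiv.Perm (Weight n)} (hw : w ∈ weylGroup n) :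
    ∃ a, IsReducedWord a ∧ wordProd a = w := by
  obtain ⟨a, ha⟩ := exists_wordProd_eq hw
  obtain ⟨b, hlength, hprod⟩ :=
    Nat.sInf_mem (s := {k | ∃ a : List (Fin n), a.length = k ∧ wordProd a = w}) ⟨_, a, rfl, ha⟩
  exact ⟨b, by rw [IsReducedWord, hprod, hlength, weylLength], hprod⟩

theorem IsReducedWord.of_cons {i : Fin n} {a : List (Fin n)} (h : IsReducedWord (i :: a)) :
    IsReducedWord a := by
  obtain ⟨b, hb, hprod⟩ := exists_isReducedWord (wordProd_mem a)
  have hle := weylLength_wordProd_le a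
  have hle_cons := weylLength_wordProd_le (i :: b)
  rw [IsReducedWord] at *
  rw [wordProd_cons, hprod, ← wordProd_cons, h, List.length_cons, List.length_cons] at hle_cons
  rw [hprod] at hb
  omega

theorem IsReducedWord.rho_nonneg {i : Fin n} {a : List (Fin n)} (h : IsReducedWord (i :: a)) :
    0 ≤ wordProd a rho i := by
  by_contra! hneg
  obtain ⟨b, hlength, hprod⟩ := exists_shorter_word a i hneg
  have hle := weylLength_wordProd_le b
  rw [← hprod, h, List.length_cons] at hle
  omega

/-! ### The longest element -/

theorem IsSignedPerm.rho_apply_ne_zero {w : Equiv.Perm (Weight n)} {σ η}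
    (hw : IsSignedPerm w σ η) (i : Fin n) : w rho i ≠ 0 := by
  by_cases hi : (i : ℕ) + 1 < n
  · have hrho := coord_of_lt hi (w rho)
    rw [hw, hw, coord_rho, coord_rho] at hrho
    have hne : σ i ≠ σ ⟨i + 1, hi⟩ := σ.injective.ne (by simp [Fin.ext_iff])
    rw [ne_eq, Fin.ext_iff] at hne
    rcases Int.units_eq_one_or (η i) with h | h <;>
      rcases Int.units_eq_one_or (η ⟨i + 1, hi⟩) with h' | h' <;>
      simp only [h, h', Units.val_one, Units.val_neg] at hrho <;> omega
  · have hrho := coord_of_not_lt hi (w rho)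
    rw [hw, coord_rho] at hrho
    rcases Int.units_eq_one_or (η i) with h | h <;>
      simp only [h, Units.val_one, Units.val_neg] at hrho <;> omega

theorem IsLongest.rho_apply_neg {w₀ : Equiv.Perm (Weight n)} (hw₀ : IsLongest w₀) (i : Fin n) :
    w₀ rho i < 0 := by
  obtain ⟨a, -, rfl⟩ := exists_isReducedWord hw₀.1
  obtain ⟨σ, η, hw⟩ := exists_isSignedPerm_wordProd a
  refine (hw.rho_apply_ne_zero i).lt_or_gt.resolve_right fun hpos => ?_
  obtain ⟨b, hb, hprod⟩ := exists_isReducedWord (wordProd_mem (i :: a))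
  have hneg : wordProd b rho i < 0 := by
    have hroot : simpleRoot i i = 2 := if_pos rfl
    rw [hprod, wordProd_cons, Equiv.Perm.mul_apply, simpleReflection_apply, Pi.sub_apply,
      Pi.smul_apply, hroot, smul_eq_mul]
    omega
  obtain ⟨c, hlength, hcons⟩ := exists_shorter_word b i hneg
  have hle := hw₀.2 _ (wordProd_mem b)
  have hle' := weylLength_wordProd_le c
  rw [← hcons, wordProd_cons, hprod, wordProd_cons, ← mul_assoc, simpleReflection_mul_self,
    one_mul] at hle'
  rw [hb] at hle
  omega

theorem coord_pos {wt : Weight n} (h : ∀ k, 0 < wt k) (a : Fin n) : 0 < coord wt a := by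
  rw [coord_apply]
  exact Finset.sum_pos (fun k _ => mul_pos (by split_ifs <;> norm_num) (h k)) ⟨a, by simp⟩

theorem coord_strictAnti {wt : Weight n} (h : ∀ k, 0 < wt k) : StrictAnti (coord wt) := by
  intro a b hab
  have hterm (k : Fin n) : 0 < (if (k : ℕ) + 1 < n then 2 else 1) * wt k :=
    mul_pos (by split_ifs <;> norm_num) (h k)
  rw [coord_apply, coord_apply]
  exact Finset.sum_lt_sum_of_subset (Finset.Ici_subset_Ici.2 hab.le) (i := a) (by simp)
    (by simpa using hab) (hterm a) fun k _ _ => (hterm k).le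

theorem IsLongest.apply {w₀ : Equiv.Perm (Weight n)} (hw₀ : IsLongest w₀) (wt : Weight n) :
    w₀ wt = -wt := by
  have hpos (k : Fin n) : 0 < (-w₀ rho) k := neg_pos.2 (hw₀.rho_apply_neg k)
  obtain ⟨a, -, rfl⟩ := exists_isReducedWord hw₀.1
  obtain ⟨σ, η, hw⟩ := exists_isSignedPerm_wordProd a
  have hcoord (k : Fin n) : coord (-wordProd a rho) k = -(η k * (2 * ((n : ℤ) - σ k) - 1)) := by
    rw [map_neg, Pi.neg_apply, hw, coord_rho]
  have hη (k : Fin n) : η k = -1 := by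
    refine (Int.units_eq_one_or (η k)).resolve_left fun h => ?_
    have := coord_pos hpos k
    rw [hcoord, h, Units.val_one] at this
    omega
  have hmono : StrictMono σ := fun k l hkl => by
    have := coord_strictAnti hpos hkl
    rw [hcoord, hcoord, hη, hη, Units.val_neg, Units.val_one] at this
    rw [Fin.lt_def]
    omega
  have hσ : ⇑σ = id := hmono.eq_id
  refine coord_injective (funext fun k => ?_)
  rw [hw, hη, hσ, map_neg, Units.val_neg, Units.val_one, neg_one_mul]
  rfl

/-! ### Generalized minors as matrix entries -/

theorem one_add_mul_one_sub_mul_one_add {A : Type*} [Ring A] {e f : A} (he : e * e = 0)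
    (hefe : e * f * e = e) : (1 + e) * (1 - f) * (1 + e) = 1 + e - f - e * f - f * e := by
  simp only [mul_add, add_mul, mul_sub, sub_mul, mul_one, one_mul, he, hefe]
  abel

theorem mat_sbar (i : Fin n) :
    mat (sbar i) = 1 - eMat i + fMat i - eMat i * fMat i - fMat i * eMat i := by
  have h := one_add_mul_one_sub_mul_one_add (e := -eMat i) (f := -fMat i)
    (by rw [neg_mul_neg, eMat_mul_self]) (by rw [neg_mul_neg, mul_neg, eMat_mul_fMat_mul_eMat])
  rw [sbar, map_mul, map_mul, mat_xSub, mat_ySub, neg_one_smul, one_smul,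
    ← sub_neg_eq_add 1 (fMat i), h, neg_mul_neg, neg_mul_neg, sub_neg_eq_add, ← sub_eq_add_neg]

theorem transpose_mat_sbar_inv (i : Fin n) : (mat (sbar i)⁻¹).transpose = mat (sbar i) := by
  have h := one_add_mul_one_sub_mul_one_add (fMat_mul_self i) (fMat_mul_eMat_mul_fMat i)
  rw [mat_sbar, sbar, mul_inv_rev, mul_inv_rev, xSub_inv, ySub_inv, neg_neg, map_mul, map_mul,
    Matrix.transpose_mul, Matrix.transpose_mul, transpose_mat_xSub, transpose_mat_ySub, mat_xSub,
    mat_ySub, neg_one_smul, one_smul, ← sub_eq_add_neg, h]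
  abel

theorem wordLift_cons (i : Fin n) (a : List (Fin n)) :
    wordLift (i :: a) = sbar i * wordLift a := by
  rw [wordLift, List.map_cons, List.prod_cons, wordLift]

theorem transpose_mat_wordLift_inv (a : List (Fin n)) :
    (mat (wordLift a)⁻¹).transpose = mat (wordLift a) := by
  induction a with
  | nil => simp [wordLift]
  | cons i a ih =>
    rw [wordLift_cons, mul_inv_rev, map_mul, Matrix.transpose_mul, ih, transpose_mat_sbar_inv,
      map_mul]

theorem fMat_mulVec_single_of_eq_some {i : Fin n} {a b : Spin n} (h : lower i a = some b) :
    (fMat i).mulVec (Pi.single a 1) = Pi.single b 1 := by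
  rw [Matrix.mulVec_single_one]
  ext c
  simp [fMat, h, Pi.single_apply, eq_comm]

theorem fMat_mulVec_single_of_eq_none {i : Fin n} {a : Spin n} (h : lower i a = none) :
    (fMat i).mulVec (Pi.single a 1) = 0 := by
  rw [Matrix.mulVec_single_one]
  ext c
  simp [fMat, h]

theorem eMat_mulVec_single_of_eq_some {i : Fin n} {a b : Spin n} (h : raise i a = some b) :
    (eMat i).mulVec (Pi.single a 1) = Pi.single b 1 := by
  rw [Matrix.mulVec_single_one]
  ext c
  simp [eMat, h, Pi.single_apply, eq_comm]

theorem eMat_mulVec_single_of_eq_none {i : Fin n} {a : Spin n} (h : raise i a = none) :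
    (eMat i).mulVec (Pi.single a 1) = 0 := by
  rw [Matrix.mulVec_single_one]
  ext c
  simp [eMat, h]

/-- If `⟨h_i, wt⟩ = -1`, then `s̄_i` would bring in a sign. -/
theorem exists_sbar_mulVec_single {i : Fin n} {a : Spin n} (ha : 0 ≤ hval i a) :
    ∃ b, simpleReflection i (spinWeight a) = spinWeight b ∧
      (mat (sbar i)).mulVec (Pi.single a 1) = Pi.single b 1 := by
  have hraise : raise i a = none := by
    rw [← Option.not_isSome_iff_eq_none, isSome_raise_iff]
    omega
  simp only [simpleReflection_apply, mat_sbar, Matrix.sub_mulVec, Matrix.add_mulVec,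
    Matrix.one_mulVec, ← Matrix.mulVec_mulVec, eMat_mulVec_single_of_eq_none hraise,
    Matrix.mulVec_zero]
  obtain h | h | h := hval_eq_or i a
  · omega
  · have hlower : lower i a = none := by
      rw [← Option.not_isSome_iff_eq_none, isSome_lower_iff, h]
      decide
    refine ⟨a, by rw [spinWeight, h, zero_smul, sub_zero], ?_⟩
    rw [fMat_mulVec_single_of_eq_none hlower, Matrix.mulVec_zero]
    abel
  · obtain ⟨b, hb⟩ := Option.isSome_iff_exists.1 (isSome_lower_iff.2 h)
    refine ⟨b, by rw [spinWeight_lower hb, spinWeight, h, one_smul], ?_⟩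
    rw [fMat_mulVec_single_of_eq_some hb,
      eMat_mulVec_single_of_eq_some (raise_eq_some_iff_lower.2 hb)]
    abel

theorem coord_spinWeight_topSpin : coord (spinWeight (topSpin n)) = 1 := coord_spinWeight _

theorem IsSignedPerm.rho_apply_neg_of_topSpin {w : Equiv.Perm (Weight n)} {σ η}
    (hw : IsSignedPerm w σ η) {i : Fin n} (h : w (spinWeight (topSpin n)) i < 0) :
    w rho i < 0 := by
  by_cases hi : (i : ℕ) + 1 < n
  · have hrho := coord_of_lt hi (w rho)
    have htop := coord_of_lt hi (w (spinWeight (topSpin n)))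
    rw [hw, hw, coord_rho, coord_rho] at hrho
    rw [hw, hw, coord_spinWeight_topSpin, Pi.one_apply, Pi.one_apply] at htop
    rcases Int.units_eq_one_or (η i) with h' | h' <;>
      rcases Int.units_eq_one_or (η ⟨i + 1, hi⟩) with h'' | h'' <;>
      simp only [h', h'', Units.val_one, Units.val_neg] at hrho htop <;> omega
  · have hrho := coord_of_not_lt hi (w rho)
    have htop := coord_of_not_lt hi (w (spinWeight (topSpin n)))
    rw [hw, coord_rho] at hrho
    rw [hw, coord_spinWeight_topSpin, Pi.one_apply] at htop
    rcases Int.units_eq_one_or (η i) with h' | h' <;>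
      simp only [h', Units.val_one, Units.val_neg] at hrho htop <;> omega

theorem IsReducedWord.exists_wordLift_mulVec {a : List (Fin n)} (ha : IsReducedWord a) :
    ∃ ε, wordProd a (spinWeight (topSpin n)) = spinWeight ε ∧
      (mat (wordLift a)).mulVec (Pi.single (topSpin n) 1) = Pi.single ε 1 := by
  induction a with
  | nil => exact ⟨topSpin n, rfl, by
    rw [wordLift, List.map_nil, List.prod_nil, map_one, Matrix.one_mulVec]⟩
  | cons i a ih =>
    obtain ⟨ε, hweight, hvec⟩ := ih ha.of_cons
    obtain ⟨σ, η, hw⟩ := exists_isSignedPerm_wordProd a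
    have hnonneg : 0 ≤ hval i ε := by
      by_contra! hneg
      refine ha.rho_nonneg.not_gt (hw.rho_apply_neg_of_topSpin ?_)
      rwa [hweight]
    rw [wordLift_cons, map_mul, ← Matrix.mulVec_mulVec, hvec, wordProd_cons,
      Equiv.Perm.mul_apply, hweight]
    exact exists_sbar_mulVec_single hnonneg

theorem mat_wordLift_inv_mul_mul_topSpin {a b : List (Fin n)} (ha : IsReducedWord a)
    (hb : IsReducedWord b) {ε ε' : Spin n}
    (hε : wordProd a (spinWeight (topSpin n)) = spinWeight ε)
    (hε' : wordProd b (spinWeight (topSpin n)) = spinWeight ε') (g : G n) :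
    mat ((wordLift a)⁻¹ * g * wordLift b) (topSpin n) (topSpin n) = mat g ε ε' := by
  obtain ⟨_, hweight, hvec⟩ := ha.exists_wordLift_mulVec
  obtain ⟨_, hweight', hvec'⟩ := hb.exists_wordLift_mulVec
  obtain rfl := spinWeight_injective (hε.symm.trans hweight)
  obtain rfl := spinWeight_injective (hε'.symm.trans hweight')
  rw [← transpose_mat_wordLift_inv, Matrix.mulVec_transpose] at hvec
  have entry (M : Matrix (Spin n) (Spin n) ℂ) (c d : Spin n) :
      M c d = Pi.single c 1 ⬝ᵥ M.mulVec (Pi.single d 1) := by simp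
  refine (entry _ _ _).trans ?_
  rw [map_mul, map_mul, ← Matrix.mulVec_mulVec, hvec', ← Matrix.mulVec_mulVec,
    Matrix.dotProduct_mulVec, hvec]
  exact (entry _ _ _).symm

theorem isGeneralizedMinor_spinWeight_iff {u v : Equiv.Perm (Weight n)} (hu : u ∈ weylGroup n)
    (hv : v ∈ weylGroup n) {ε ε' : Spin n} (hε : u (spinWeight (topSpin n)) = spinWeight ε)
    (hε' : v (spinWeight (topSpin n)) = spinWeight ε') (D : G n → ℂ) :
    IsGeneralizedMinor (spinWeight (topSpin n)) (spinWeight ε) (spinWeight ε') D ↔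
      D = fun g => mat g ε ε' := by
  constructor
  · rintro ⟨D₀, hD₀, a, b, ha, hb, hwa, hwb, hD⟩
    obtain rfl := hD₀.unique isPrincipalMinor_mat_topSpin
    funext g
    exact (hD g).trans (mat_wordLift_inv_mul_mul_topSpin ha hb hwa hwb g)
  · rintro rfl
    obtain ⟨a, ha, rfl⟩ := exists_isReducedWord hu
    obtain ⟨b, hb, rfl⟩ := exists_isReducedWord hv
    exact ⟨_, isPrincipalMinor_mat_topSpin, a, b, ha, hb, hε, hε',
      fun g => (mat_wordLift_inv_mul_mul_topSpin ha hb hε hε' g).symm⟩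

/-- The basis vector `(-, …, -, +)` of the spin representation. -/
def cutSpin (n : ℕ) : Spin n := fun i => decide ((i : ℕ) + 1 = n)

theorem IsLongest.apply_simpleReflection_lastIdx (hn : 1 ≤ n) {w₀ : Equiv.Perm (Weight n)}
    (hw₀ : IsLongest w₀) :
    w₀ (simpleReflection (lastIdx n hn) (spinWeight (topSpin n))) = spinWeight (cutSpin n) := by
  have hlast : ¬ (lastIdx n hn : ℕ) + 1 < n := by simp only [lastIdx]; omega
  have hlast_iff (k : Fin n) : k = lastIdx n hn ↔ (k : ℕ) + 1 = n := by
    simp only [Fin.ext_iff, lastIdx]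
    omega
  refine coord_injective (funext fun k => ?_)
  rw [hw₀.apply, map_neg, Pi.neg_apply, coord_simpleReflection_of_not_lt hlast,
    coord_spinWeight_topSpin, coord_spinWeight]
  by_cases hk : (k : ℕ) + 1 = n <;> simp [hlast_iff, hk, cutSpin, sgn]

theorem isGeneralizedMinor_longest_iff (hn : 1 ≤ n) {w₀ : Equiv.Perm (Weight n)}
    (hw₀ : IsLongest w₀) (D : G n → ℂ) :
    IsGeneralizedMinor (fundWeight (lastIdx n hn))
        (w₀ (simpleReflection (lastIdx n hn) (fundWeight (lastIdx n hn))))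
        (fundWeight (lastIdx n hn)) D ↔ D = fun g => mat g (cutSpin n) (topSpin n) := by
  have happly := hw₀.apply_simpleReflection_lastIdx hn
  rw [← spinWeight_topSpin hn, happly]
  exact isGeneralizedMinor_spinWeight_iff (mul_mem hw₀.1 (simpleReflection_mem (lastIdx n hn)))
    (one_mem _) happly rfl D

section Sweeps

variable {K : Type*} [Field K]

/-- The recursion for a product of factors `𝐲_0(γ 0) ⋯ 𝐲_n(γ n)` in the spin representation: `F j S`
is the coordinate, at the basis vector whose set of minus signs is `S ⊆ {0, …, n}`, of the image of
a vector under the product of the factors with index at least `j`. -/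
structure IsSweep (n : ℕ) (γ : ℕ → K) (F : ℕ → Finset ℕ → K) : Prop where
  move : ∀ {i S}, i < n → i ∈ S → i + 1 ∉ S →
    F i S = γ i * F (i + 1) S + F (i + 1) (insert (i + 1) (S.erase i))
  move_last : ∀ {S}, n ∈ S → F n S = γ n * F (n + 1) S + F (n + 1) (S.erase n)
  stay : ∀ {i S}, i < n → i ∉ S → i + 1 ∈ S → F i S = (γ i)⁻¹ * F (i + 1) S
  stay_last : ∀ {S}, n ∉ S → F n S = (γ n)⁻¹ * F (n + 1) S
  skip : ∀ {i S}, i < n → (i ∈ S ↔ i + 1 ∈ S) → F i S = F (i + 1) S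

/-- The coordinates `ψ` of a vector of the spin representation vanish at the basis vectors with more
than `k` minus signs. -/
def VanishesAbove (n k : ℕ) (ψ : Finset ℕ → K) : Prop :=
  ∀ S ⊆ Finset.range (n + 1), k < S.card → ψ S = 0

namespace IsSweep

variable {γ : ℕ → K} {F : ℕ → Finset ℕ → K}

theorem eq_of_forall_mem_iff (hF : IsSweep n γ F) {S : Finset ℕ} {j k : ℕ} (hjk : j ≤ k)
    (hk : k ≤ n) (h : ∀ l, j ≤ l → l < k → (l ∈ S ↔ l + 1 ∈ S)) : F j S = F k S := by
  induction k, hjk using Nat.le_induction with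
  | base => rfl
  | succ k hjk ih =>
    rw [ih (by omega) fun l hjl hlk => h l hjl (by omega), hF.skip hk (h k hjk k.lt_succ_self)]

theorem eq_zero_of_subset_range (hF : IsSweep n γ F) {k : ℕ} (hψ : VanishesAbove n k (F (n + 1)))
    {j : ℕ} (hj : j ≤ n + 1) {S : Finset ℕ} (hS : S ⊆ Finset.range j) (hk : k < S.card) :
    F j S = 0 := by
  rcases hj.eq_or_lt with rfl | hj
  · exact hψ S hS hk
  · have hn : n ∉ S := by grind
    rw [hF.eq_of_forall_mem_iff (k := n) (by omega) le_rfl (by grind), hF.stay_last hn,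
      hψ S (by grind) hk, mul_zero]

theorem vanishesAbove (hF : IsSweep n γ F) {k : ℕ} (hψ : VanishesAbove n k (F (n + 1))) {j : ℕ}
    (hj : j ≤ n + 1) : VanishesAbove n (k + 1) (F j) := by
  induction hj using Nat.decreasingInduction with
  | self => exact fun S hS hk => hψ S hS (by omega)
  | of_succ j hj ih =>
    intro S hS hk
    rcases Nat.lt_succ_iff_lt_or_eq.1 hj with hjn | rfl
    · by_cases hmem : j ∈ S <;> by_cases hmem' : j + 1 ∈ S
      · rw [hF.skip hjn (by simp [hmem, hmem']), ih S hS hk]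
      · rw [hF.move hjn hmem hmem', ih S hS hk, ih _ (by grind) (by grind), mul_zero, add_zero]
      · rw [hF.stay hjn hmem hmem', ih S hS hk, mul_zero]
      · rw [hF.skip hjn (by simp [hmem, hmem']), ih S hS hk]
    · by_cases hmem : j ∈ S
      · rw [hF.move_last hmem, ih S hS hk, hψ _ (by grind) (by grind), mul_zero, add_zero]
      · rw [hF.stay_last hmem, ih S hS hk, mul_zero]

/-- Since vectors with more minus signs than `S` do not contribute, the last minus sign has to run
through to the end and disappear. -/
theorem apply_insert (hF : IsSweep n γ F) {S : Finset ℕ} (hψ : VanishesAbove n S.card (F (n + 1)))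
    {p : ℕ} (hp : p ≤ n) (hS : S ⊆ Finset.range p) : F p (insert p S) = F (n + 1) S := by
  induction hp using Nat.decreasingInduction with
  | self =>
    have hn : n ∉ S := by grind
    rw [hF.move_last (S.mem_insert_self n), Finset.erase_insert hn,
      hψ (insert n S) (by grind) (by grind), mul_zero, zero_add]
  | of_succ p hp ih =>
    have hpS : p ∉ S := by grind
    rw [hF.move hp (S.mem_insert_self p) (by grind), Finset.erase_insert hpS, ih (by grind),
      hF.eq_zero_of_subset_range hψ (by omega) (by grind) (by grind), mul_zero, zero_add]

theorem apply_succ_insert_insert (hF : IsSweep n γ F) {R : Finset ℕ} {i p : ℕ}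
    (hψ : VanishesAbove n (R.card + 1) (F (n + 1))) (hR : R ⊆ Finset.range i) (hip : i < p)
    (hp : p < n) :
    F (i + 1) (insert (p + 1) (insert i R)) = (γ p)⁻¹ * F (n + 1) (insert i R) := by
  have hi : i ∉ R := by grind
  rw [hF.eq_of_forall_mem_iff (k := p) (by omega) hp.le (by grind), hF.stay hp (by grind) (by simp),
    hF.apply_insert (by rwa [Finset.card_insert_of_notMem hi]) hp (by grind)]

/-- The minus sign at `i` stops at some `k ≤ p` and the one at `p + 1` disappears; the factor with
index `p` scales by `(γ p)⁻¹` unless `k = p`. -/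
theorem apply_insert_insert (hF : IsSweep n γ F) {R : Finset ℕ} {i p : ℕ}
    (hψ : VanishesAbove n (R.card + 1) (F (n + 1))) (hR : R ⊆ Finset.range i) (hip : i ≤ p)
    (hp : p < n) :
    F i (insert (p + 1) (insert i R)) =
      (γ p)⁻¹ * ∑ k ∈ Finset.Ico i p, γ k * F (n + 1) (insert k R) + F (n + 1) (insert p R) := by
  induction hip using Nat.decreasingInduction with
  | self =>
    have hpR : p ∉ R := by grind
    rw [hF.skip hp (by simp),
      hF.apply_insert (by rwa [Finset.card_insert_of_notMem hpR]) hp (by grind)]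
    simp
  | of_succ i hi ih =>
    have hmove : insert (i + 1) ((insert (p + 1) (insert i R)).erase i) =
        insert (p + 1) (insert (i + 1) R) := by grind
    rw [hF.move (by omega) (by simp) (by grind), hmove, ih (by grind),
      hF.apply_succ_insert_insert hψ hR hi hp, Finset.sum_eq_sum_Ico_succ_bot hi]
    ring

theorem apply_insert_last (hF : IsSweep n γ F) {R : Finset ℕ} {i : ℕ} (hR : R ⊆ Finset.range i)
    (hi : i ≤ n) :
    F i (insert i R) = (γ n)⁻¹ * ∑ k ∈ Finset.Ico i n, γ k * F (n + 1) (insert k R) +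
      γ n * F (n + 1) (insert n R) + F (n + 1) R := by
  induction hi using Nat.decreasingInduction with
  | self =>
    have hn : n ∉ R := by grind
    rw [hF.move_last (by simp), Finset.erase_insert hn]
    simp
  | of_succ i hi ih =>
    have hiR : i ∉ R := by grind
    rw [hF.move hi (by simp) (by grind), Finset.erase_insert hiR, ih (by grind),
      hF.eq_of_forall_mem_iff (j := i + 1) (k := n) (by omega) le_rfl (by grind),
      hF.stay_last (by grind), Finset.sum_eq_sum_Ico_succ_bot hi]
    ring

theorem apply_zero_insert_range (hF : IsSweep n γ F) {m p : ℕ}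
    (hψ : VanishesAbove n (m + 1) (F (n + 1))) (hm : m ≤ p) (hp : p < n) :
    F 0 (insert (p + 1) (Finset.range (m + 1))) =
      (γ p)⁻¹ * ∑ k ∈ Finset.Ico m p, γ k * F (n + 1) (insert k (Finset.range m)) +
        F (n + 1) (insert p (Finset.range m)) := by
  rw [hF.eq_of_forall_mem_iff (k := m) m.zero_le (by omega) (by grind), Finset.range_add_one,
    hF.apply_insert_insert (by simpa using hψ) subset_rfl hm hp]

theorem apply_zero_range (hF : IsSweep n γ F) {m : ℕ} (hm : m ≤ n) :
    F 0 (Finset.range (m + 1)) =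
      (γ n)⁻¹ * ∑ k ∈ Finset.Ico m n, γ k * F (n + 1) (insert k (Finset.range m)) +
        γ n * F (n + 1) (insert n (Finset.range m)) + F (n + 1) (Finset.range m) := by
  rw [hF.eq_of_forall_mem_iff (k := m) m.zero_le hm (by grind), Finset.range_add_one,
    hF.apply_insert_last subset_rfl hm]

theorem apply_zero_singleton_succ (hF : IsSweep n γ F) {p : ℕ}
    (hψ : VanishesAbove n 0 (F (n + 1))) (hp : p < n) :
    F 0 {p + 1} = (γ p)⁻¹ * F (n + 1) ∅ := by
  rw [hF.eq_of_forall_mem_iff (k := p) p.zero_le hp.le (by grind), hF.stay hp (by simp) (by simp),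
    ← insert_empty_eq, hF.apply_insert (by simpa using hψ) hp (by simp)]

theorem apply_zero_singleton_zero (hF : IsSweep n γ F) (hψ : VanishesAbove n 0 (F (n + 1))) :
    F 0 {0} = F (n + 1) ∅ := by
  rw [← insert_empty_eq, hF.apply_insert (by simpa using hψ) n.zero_le (by simp)]

theorem apply_zero_empty (hF : IsSweep n γ F) : F 0 ∅ = (γ n)⁻¹ * F (n + 1) ∅ := by
  rw [hF.eq_of_forall_mem_iff (k := n) n.zero_le le_rfl (by simp), hF.stay_last (by simp)]

end IsSweep

theorem count_mem_of_subset_range {P : Finset ℕ} {r : ℕ} (hP : P ⊆ Finset.range r) :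
    Nat.count (· ∈ P) r = P.card := by
  rw [Nat.count_eq_card_filter_range, Finset.filter_mem_eq_inter, Finset.inter_eq_right.2 hP]

theorem count_mem_congr {P Q : Finset ℕ} {r : ℕ} (h : ∀ k < r, (k ∈ P ↔ k ∈ Q)) :
    Nat.count (· ∈ P) r = Nat.count (· ∈ Q) r := by
  rw [Nat.count_eq_card_filter_range, Nat.count_eq_card_filter_range,
    Finset.filter_congr fun k hk => h k (Finset.mem_range.1 hk)]

theorem sum_powersetCard_range_succ {M : Type*} [AddCommMonoid M] (f : Finset ℕ → M) (m p : ℕ) :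
    ∑ P ∈ Finset.powersetCard (m + 1) (Finset.range (p + 1)), f P =
      ∑ P ∈ Finset.powersetCard (m + 1) (Finset.range p), f P +
        ∑ P ∈ Finset.powersetCard m (Finset.range p), f (insert p P) := by
  rw [Finset.range_add_one, Finset.powersetCard_succ_insert Finset.notMem_range_self,
    Finset.sum_union, Finset.sum_image]
  · intro P hP Q hQ h
    have hpP : p ∉ P := by grind
    have hpQ : p ∉ Q := by grind
    rw [← Finset.erase_insert hpP, h, Finset.erase_insert hpQ]
  · grind [Finset.disjoint_left]

/-- The contribution to the weight of a set of steps `P` of the passage from site `i` to site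
`i + 1`; it depends on the number of steps up to `i`. -/
def rowWeight (g : ℕ → ℕ → K) (P : Finset ℕ) (i : ℕ) : K :=
  if i ∉ P ∧ i + 1 ∈ P then (g (Nat.count (· ∈ P) (i + 1)) i)⁻¹
  else if i ∈ P ∧ i + 1 ∉ P then g (Nat.count (· ∈ P) (i + 1)) i
  else 1

/-- The product of the contributions to the weight of `P` of the first `p` rows. -/
def partialWeight (g : ℕ → ℕ → K) (p : ℕ) (P : Finset ℕ) : K :=
  ∏ i ∈ Finset.range p, rowWeight g P i

theorem rowWeight_congr (g : ℕ → ℕ → K) {P Q : Finset ℕ} {i : ℕ}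
    (h : ∀ k ≤ i + 1, (k ∈ P ↔ k ∈ Q)) : rowWeight g P i = rowWeight g Q i := by
  simp only [rowWeight, h i (by omega), h (i + 1) le_rfl,
    count_mem_congr (r := i + 1) fun k hk => h k (by omega)]

theorem partialWeight_congr (g : ℕ → ℕ → K) {P Q : Finset ℕ} {p : ℕ}
    (h : ∀ k ≤ p, (k ∈ P ↔ k ∈ Q)) : partialWeight g p P = partialWeight g p Q :=
  Finset.prod_congr rfl fun _ hi => rowWeight_congr g fun k hk =>
    h k (hk.trans (Finset.mem_range.1 hi))

theorem partialWeight_succ (g : ℕ → ℕ → K) {P : Finset ℕ} {p : ℕ} (hP : P ⊆ Finset.range p) :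
    partialWeight g (p + 1) P = partialWeight g p P := by
  rw [partialWeight, Finset.prod_range_succ, rowWeight, if_neg (by grind), if_neg (by grind),
    mul_one, partialWeight]

theorem partialWeight_succ_insert (g : ℕ → ℕ → K) {P : Finset ℕ} {p : ℕ}
    (hP : P ⊆ Finset.range p) :
    partialWeight g (p + 1) (insert p P) = g (P.card + 1) p * partialWeight g p (insert p P) := by
  have hpP : p ∉ P := by grind
  rw [partialWeight, Finset.prod_range_succ, rowWeight, if_neg (by grind), if_pos (by grind),
    count_mem_of_subset_range (by grind), Finset.card_insert_of_notMem hpP, mul_comm,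
    partialWeight]

theorem partialWeight_succ_insert_succ (g : ℕ → ℕ → K) {P : Finset ℕ} {p : ℕ}
    (hP : P ⊆ Finset.range p) :
    partialWeight g (p + 1) (insert (p + 1) P) = (g P.card p)⁻¹ * partialWeight g p P := by
  have hcount : Nat.count (· ∈ insert (p + 1) P) (p + 1) = P.card := by
    rw [count_mem_congr (Q := P) (by grind), count_mem_of_subset_range (by grind)]
  rw [partialWeight, Finset.prod_range_succ, rowWeight, if_pos (by grind), hcount, mul_comm,
    ← partialWeight, partialWeight_congr g (Q := P) (by grind)]

theorem partialWeight_succ_insert_insert (g : ℕ → ℕ → K) (P : Finset ℕ) (p : ℕ) :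
    partialWeight g (p + 1) (insert (p + 1) (insert p P)) = partialWeight g p (insert p P) := by
  rw [partialWeight, Finset.prod_range_succ, rowWeight, if_neg (by simp), if_neg (by simp),
    mul_one, ← partialWeight, partialWeight_congr g (Q := insert p P) (by grind)]

/-- The generating function of the sets of `m` steps among the first `p`. -/
def stepSum (g : ℕ → ℕ → K) (m p : ℕ) : K :=
  ∑ P ∈ Finset.powersetCard m (Finset.range p), partialWeight g p P

/-- The generating function of the sets of `m` steps among the first `p`, if the next step `p` is
taken as well. -/
def stepSumInsert (g : ℕ → ℕ → K) (m p : ℕ) : K :=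
  ∑ P ∈ Finset.powersetCard m (Finset.range p), partialWeight g p (insert p P)

theorem sum_partialWeight_succ_insert_succ (g : ℕ → ℕ → K) (m p : ℕ) :
    ∑ P ∈ Finset.powersetCard m (Finset.range p), partialWeight g (p + 1) (insert (p + 1) P) =
      (g m p)⁻¹ * stepSum g m p := by
  rw [stepSum, Finset.mul_sum]
  refine Finset.sum_congr rfl fun P hP => ?_
  obtain ⟨hsub, rfl⟩ := Finset.mem_powersetCard.1 hP
  exact partialWeight_succ_insert_succ g hsub

theorem stepSum_zero (g : ℕ → ℕ → K) (p : ℕ) : stepSum g 0 p = 1 := by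
  simp [stepSum, partialWeight, rowWeight]

theorem stepSumInsert_zero_zero (g : ℕ → ℕ → K) : stepSumInsert g 0 0 = 1 := by
  simp [stepSumInsert, partialWeight]

theorem stepSumInsert_zero_succ (g : ℕ → ℕ → K) (p : ℕ) :
    stepSumInsert g 0 (p + 1) = (g 0 p)⁻¹ := by
  simpa [stepSumInsert, stepSum_zero] using sum_partialWeight_succ_insert_succ g 0 p

theorem stepSumInsert_succ_succ (g : ℕ → ℕ → K) (m p : ℕ) :
    stepSumInsert g (m + 1) (p + 1) =
      (g (m + 1) p)⁻¹ * stepSum g (m + 1) p + stepSumInsert g m p := by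
  rw [stepSumInsert, sum_powersetCard_range_succ, sum_partialWeight_succ_insert_succ]
  simp only [partialWeight_succ_insert_insert]
  rfl

theorem stepSum_succ_succ (g : ℕ → ℕ → K) (m p : ℕ) :
    stepSum g (m + 1) (p + 1) = stepSum g (m + 1) p + g (m + 1) p * stepSumInsert g m p := by
  rw [stepSum, sum_powersetCard_range_succ, stepSumInsert, Finset.mul_sum]
  refine congrArg₂ _ (Finset.sum_congr rfl fun P hP => ?_) (Finset.sum_congr rfl fun P hP => ?_)
  · exact partialWeight_succ g (Finset.mem_powersetCard.1 hP).1
  · obtain ⟨hsub, rfl⟩ := Finset.mem_powersetCard.1 hP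
    exact partialWeight_succ_insert g hsub

theorem stepSum_succ_eq_sum (g : ℕ → ℕ → K) {m p : ℕ} (hmp : m ≤ p) :
    stepSum g (m + 1) p = ∑ k ∈ Finset.Ico m p, g (m + 1) k * stepSumInsert g m k := by
  induction p, hmp using Nat.le_induction with
  | base => simp [stepSum, Finset.powersetCard_eq_empty.2]
  | succ p hmp ih => rw [stepSum_succ_succ, ih, Finset.sum_Ico_succ_top hmp]

/-- The weight of a set of steps `P ⊆ {0, …, n}`. -/
def stepWeight (g : ℕ → ℕ → K) (n : ℕ) (P : Finset ℕ) : K :=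
  partialWeight g n P * if n ∈ P then g P.card n else (g P.card n)⁻¹

/-- The generating function of the sets of `m` steps among `n + 1`. -/
def stepWeightSum (g : ℕ → ℕ → K) (n m : ℕ) : K :=
  ∑ P ∈ Finset.powersetCard m (Finset.range (n + 1)), stepWeight g n P

theorem stepWeightSum_zero (g : ℕ → ℕ → K) (n : ℕ) : stepWeightSum g n 0 = (g 0 n)⁻¹ := by
  simp [stepWeightSum, stepWeight, partialWeight, rowWeight]

theorem stepWeightSum_succ (g : ℕ → ℕ → K) (n m : ℕ) :
    stepWeightSum g n (m + 1) =
      (g (m + 1) n)⁻¹ * stepSum g (m + 1) n + g (m + 1) n * stepSumInsert g m n := by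
  rw [stepWeightSum, sum_powersetCard_range_succ, stepSum, stepSumInsert, Finset.mul_sum,
    Finset.mul_sum]
  refine congrArg₂ _ (Finset.sum_congr rfl fun P hP => ?_) (Finset.sum_congr rfl fun P hP => ?_)
    <;> obtain ⟨hsub, hcard⟩ := Finset.mem_powersetCard.1 hP
    <;> have hn : n ∉ P := by grind
  · rw [stepWeight, if_neg hn, hcard, mul_comm]
  · rw [stepWeight, if_pos (P.mem_insert_self n), Finset.card_insert_of_notMem hn, hcard, mul_comm]

theorem sum_stepWeight (g : ℕ → ℕ → K) (n : ℕ) :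
    ∑ P ∈ (Finset.range (n + 1)).powerset \ {Finset.range (n + 1)}, stepWeight g n P =
      ∑ k ∈ Finset.range (n + 1), stepWeightSum g n k := by
  have htop : stepWeightSum g n (n + 1) = stepWeight g n (Finset.range (n + 1)) := by
    have := Finset.powersetCard_self (Finset.range (n + 1))
    rw [Finset.card_range] at this
    rw [stepWeightSum, this, Finset.sum_singleton]
  rw [Finset.sum_sdiff_eq_sub (by simp), Finset.sum_singleton, sub_eq_iff_eq_add, ← htop,
    ← Finset.sum_range_succ, Finset.sum_powerset, Finset.card_range]
  rfl

/-! ### Iterated sweeps -/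

section IteratedSweeps

variable {g : ℕ → ℕ → K} {ψ : ℕ → Finset ℕ → K}

/-- Each of the vectors `ψ (m + 1)` is obtained from `ψ m` by a sweep with parameters `g m`. -/
def IsSweepSequence (n : ℕ) (g : ℕ → ℕ → K) (ψ : ℕ → Finset ℕ → K) : Prop :=
  ∀ m ≤ n, ∃ F, IsSweep n (g m) F ∧ F (n + 1) = ψ m ∧ F 0 = ψ (m + 1)

namespace IsSweepSequence

theorem vanishesAbove (hψ : IsSweepSequence n g ψ) (hψ₀ : VanishesAbove n 0 (ψ 0)) {m : ℕ}
    (hm : m ≤ n + 1) : VanishesAbove n m (ψ m) := by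
  induction m with
  | zero => exact hψ₀
  | succ m ih =>
    obtain ⟨F, hF, hend, hstart⟩ := hψ m (by omega)
    rw [← hstart]
    refine hF.vanishesAbove ?_ (Nat.zero_le _)
    rw [hend]
    exact ih (by omega)

theorem apply_insert_range (hψ : IsSweepSequence n g ψ) (hψ₀ : VanishesAbove n 0 (ψ 0))
    (hone : ψ 0 ∅ = 1) {m p : ℕ} (hmp : m ≤ p) (hp : p ≤ n) :
    ψ (m + 1) (insert p (Finset.range m)) = stepSumInsert g m p := by
  induction m generalizing p with
  | zero =>
    obtain ⟨F, hF, hend, hstart⟩ := hψ 0 (Nat.zero_le n)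
    rw [← hend] at hψ₀ hone
    rw [← hstart, Finset.range_zero, insert_empty_eq]
    cases p with
    | zero => rw [hF.apply_zero_singleton_zero hψ₀, hone, stepSumInsert_zero_zero]
    | succ p =>
      rw [hF.apply_zero_singleton_succ hψ₀ hp, hone, mul_one, stepSumInsert_zero_succ]
  | succ m ih =>
    obtain ⟨p, rfl⟩ := Nat.exists_eq_add_of_lt (Nat.lt_of_succ_le hmp)
    obtain ⟨F, hF, hend, hstart⟩ := hψ (m + 1) (by omega)
    have hvanish := hψ.vanishesAbove hψ₀ (m := m + 1) (by omega)
    rw [← hend] at hvanish ih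
    rw [← hstart, hF.apply_zero_insert_range hvanish (by omega) hp, ih (by omega) (by omega),
      stepSumInsert_succ_succ, stepSum_succ_eq_sum g (by omega)]
    congr 2
    refine Finset.sum_congr rfl fun k hk => ?_
    rw [ih (Finset.mem_Ico.1 hk).1 (by grind)]

theorem apply_range (hψ : IsSweepSequence n g ψ) (hψ₀ : VanishesAbove n 0 (ψ 0))
    (hone : ψ 0 ∅ = 1) {m : ℕ} (hm : m ≤ n) :
    ψ (m + 1) (Finset.range m) = ∑ k ∈ Finset.range (m + 1), stepWeightSum g n k := by
  induction m with
  | zero =>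
    obtain ⟨F, hF, hend, hstart⟩ := hψ 0 hm
    rw [← hstart, Finset.range_zero, hF.apply_zero_empty, hend, hone]
    simp [stepWeightSum_zero]
  | succ m ih =>
    obtain ⟨F, hF, hend, hstart⟩ := hψ (m + 1) hm
    have hinsert {k : ℕ} (hmk : m ≤ k) (hk : k ≤ n) :
        F (n + 1) (insert k (Finset.range m)) = stepSumInsert g m k := by
      rw [hend, hψ.apply_insert_range hψ₀ hone hmk hk]
    rw [← hstart, hF.apply_zero_range (by omega), hinsert (by omega) le_rfl, hend, ih (by omega),
      Finset.sum_range_succ _ (m + 1), stepWeightSum_succ, stepSum_succ_eq_sum g (by omega),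
      add_comm, ← hend]
    congr 3
    refine Finset.sum_congr rfl fun k hk => ?_
    rw [hinsert (Finset.mem_Ico.1 hk).1 (Finset.mem_Ico.1 hk).2.le]

end IsSweepSequence

end IteratedSweeps

end Sweeps

theorem mat_alphaCheck_mul_apply (i : Fin n) (c : ℂˣ) (g : G n) (a b : Spin n) :
    mat (alphaCheck i c * g) a b = (c : ℂ) ^ hval i a * mat g a b := by
  rw [map_mul, mat_alphaCheck, Matrix.diagonal_mul]

theorem mat_ySub_mul_apply_of_raise {i : Fin n} {a a' : Spin n} (h : raise i a = some a') (t : ℂ)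
    (g : G n) (b : Spin n) : mat (ySub i t * g) a b = mat g a b + t * mat g a' b := by
  have hlower : (lowerPEquiv i).symm a = some a' := h
  rw [map_mul, mat_ySub, add_mul, one_mul, smul_mul_assoc, Matrix.add_apply, Matrix.smul_apply,
    fMat_eq_toMatrix, PEquiv.toMatrix_mul_apply]
  simp [hlower]

theorem mat_ySub_mul_apply_of_raise_eq_none {i : Fin n} {a : Spin n} (h : raise i a = none) (t : ℂ)
    (g : G n) (b : Spin n) : mat (ySub i t * g) a b = mat g a b := by
  have hlower : (lowerPEquiv i).symm a = none := h
  rw [map_mul, mat_ySub, add_mul, one_mul, smul_mul_assoc, Matrix.add_apply, Matrix.smul_apply,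
    fMat_eq_toMatrix, PEquiv.toMatrix_mul_apply]
  simp [hlower]

theorem hval_of_raise {i : Fin n} {a b : Spin n} (h : raise i a = some b) :
    hval i a = -1 ∧ hval i b = 1 :=
  ⟨isSome_raise_iff.1 (by rw [h, Option.isSome_some]),
    isSome_lower_iff.1 (by rw [raise_eq_some_iff_lower.1 h, Option.isSome_some])⟩

theorem mat_yBold_mul_apply_of_raise {i : Fin n} {a a' : Spin n} (h : raise i a = some a') (c : ℂˣ)
    (g : G n) (b : Spin n) : mat (yBold i c * g) a b = c * mat g a b + mat g a' b := by
  obtain ⟨hval_a, hval_a'⟩ := hval_of_raise h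
  rw [yBold, mul_assoc, mat_ySub_mul_apply_of_raise h, mat_alphaCheck_mul_apply,
    mat_alphaCheck_mul_apply, hval_a, hval_a']
  simp

theorem mat_yBold_mul_apply_of_hval_ne {i : Fin n} {a : Spin n} (h : hval i a ≠ -1) (c : ℂˣ)
    (g : G n) (b : Spin n) : mat (yBold i c * g) a b = (c : ℂ)⁻¹ ^ hval i a * mat g a b := by
  have hraise : raise i a = none := by
    rwa [← Option.not_isSome_iff_eq_none, isSome_raise_iff]
  rw [yBold, mul_assoc, mat_ySub_mul_apply_of_raise_eq_none hraise, mat_alphaCheck_mul_apply,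
    Units.val_inv_eq_inv_val]

/-- The basis vector of the spin representation with set of minus signs `S`. -/
def minusSpin (n : ℕ) (S : Finset ℕ) : Spin n := fun k => decide ((k : ℕ) ∉ S)

theorem raise_minusSpin {i : Fin n} {S : Finset ℕ} (hi : (i : ℕ) + 1 < n) (hmem : (i : ℕ) ∈ S)
    (hmem' : (i : ℕ) + 1 ∉ S) :
    raise i (minusSpin n S) = some (minusSpin n (insert ((i : ℕ) + 1) (S.erase i))) := by
  rw [raise, dif_pos hi, if_pos (by simp [minusSpin, hmem, hmem'])]
  refine congrArg some (funext fun k => ?_)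
  simp only [minusSpin, Function.update_apply, Fin.ext_iff, Finset.mem_insert, Finset.mem_erase]
  split_ifs <;> simp_all

theorem raise_minusSpin_last {S : Finset ℕ} (hmem : n ∈ S) :
    raise (Fin.last n) (minusSpin (n + 1) S) = some (minusSpin (n + 1) (S.erase n)) := by
  rw [raise, dif_neg (by simp), if_pos (by simp [minusSpin, hmem])]
  refine congrArg some (funext fun k => ?_)
  simp only [minusSpin, Function.update_apply, Fin.ext_iff, Finset.mem_erase, Fin.val_last]
  split_ifs <;> simp_all

theorem prod_drop_ofFn {M : Type*} [Monoid M] (f : Fin n → M) (i : Fin n) :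
    ((List.ofFn f).drop i).prod = f i * ((List.ofFn f).drop (i + 1)).prod := by
  rw [List.drop_eq_getElem_cons (by simp), List.prod_cons, List.getElem_ofFn]

theorem isSweep_mat (γ : Fin (n + 1) → ℂˣ) (g : G (n + 1)) (b : Spin (n + 1)) :
    IsSweep n (fun i => (γ (Fin.ofNat (n + 1) i) : ℂ)) fun j S =>
      mat (((List.ofFn fun i => yBold i (γ i)).drop j).prod * g) (minusSpin (n + 1) S) b := by
  have hdrop (i : Fin (n + 1)) (a : Spin (n + 1)) :
      mat (((List.ofFn fun i => yBold i (γ i)).drop i).prod * g) a b =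
        mat (yBold i (γ i) * (((List.ofFn fun i => yBold i (γ i)).drop (i + 1)).prod * g)) a b := by
    rw [prod_drop_ofFn, mul_assoc]
  have hsite {i : ℕ} (hi : i < n) : ∃ k : Fin (n + 1), Fin.ofNat (n + 1) i = k ∧ (k : ℕ) = i :=
    ⟨_, rfl, Nat.mod_eq_of_lt (by omega)⟩
  have hlast : Fin.ofNat (n + 1) n = Fin.last n := Fin.ext (by simp)
  constructor
  case move =>
    intro i S hi hmem hmem'
    obtain ⟨k, hk, rfl⟩ := hsite hi
    rw [hk, hdrop, mat_yBold_mul_apply_of_raise (raise_minusSpin (by omega) hmem hmem')]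
  case move_last =>
    intro S hmem
    rw [hlast]
    exact (hdrop (Fin.last n) _).trans
      (mat_yBold_mul_apply_of_raise (raise_minusSpin_last hmem) _ _ _)
  case stay =>
    intro i S hi hmem hmem'
    obtain ⟨k, hk, rfl⟩ := hsite hi
    have hval_eq : hval k (minusSpin (n + 1) S) = 1 := by
      simp [hval, minusSpin, hi, hmem, hmem']
    rw [hk, hdrop, mat_yBold_mul_apply_of_hval_ne (by rw [hval_eq]; decide), hval_eq, zpow_one]
  case stay_last =>
    intro S hmem
    have hval_eq : hval (Fin.last n) (minusSpin (n + 1) S) = 1 := by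
      simp [hval, minusSpin, hmem]
    rw [hlast]
    refine (hdrop (Fin.last n) _).trans ?_
    rw [mat_yBold_mul_apply_of_hval_ne (by rw [hval_eq]; decide), hval_eq, zpow_one, Fin.val_last]
  case skip =>
    intro i S hi hiff
    obtain ⟨k, hk, rfl⟩ := hsite hi
    have hval_eq : hval k (minusSpin (n + 1) S) = 0 := by
      simp [hval, minusSpin, hi, hiff]
    rw [hdrop, mat_yBold_mul_apply_of_hval_ne (by rw [hval_eq]; decide), hval_eq, zpow_zero,
      one_mul]

theorem minusSpin_empty (n : ℕ) : minusSpin n ∅ = topSpin n := by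
  funext k
  simp [minusSpin, topSpin]

theorem minusSpin_range (n : ℕ) : minusSpin (n + 1) (Finset.range n) = cutSpin (n + 1) := by
  funext k
  simp only [minusSpin, cutSpin, Finset.mem_range, decide_eq_decide]
  omega

theorem minusSpin_ne_topSpin {S : Finset ℕ} (hS : S ⊆ Finset.range n) (hne : S.Nonempty) :
    minusSpin n S ≠ topSpin n := by
  obtain ⟨k, hk⟩ := hne
  intro heq
  have hcoord := congrFun heq ⟨k, Finset.mem_range.1 (hS hk)⟩
  simp [minusSpin, topSpin, hk] at hcoord

/-- The product of the last `m` of the `n` blocks `𝐲_1(c_1^{(j)}) ⋯ 𝐲_n(c_n^{(j)})` of `Θ⁻(c)`. -/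
noncomputable def thetaTail (c : Fin n → ℤ → ℂˣ) (m : ℕ) : G n :=
  ((List.ofFn fun j : Fin n =>
    (List.ofFn fun i : Fin n => yBold i (c i (((j : ℕ) : ℤ) + 1))).prod).drop (n - m)).prod

theorem thetaTail_zero (c : Fin n → ℤ → ℂˣ) : thetaTail c 0 = 1 := by
  rw [thetaTail, List.drop_of_length_le (by simp), List.prod_nil]

theorem thetaTail_self (c : Fin n → ℤ → ℂˣ) : thetaTail c n = Theta c := by
  rw [thetaTail, Nat.sub_self, List.drop_zero, Theta]

theorem thetaTail_succ (c : Fin n → ℤ → ℂˣ) {m : ℕ} (hm : m < n) :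
    thetaTail c (m + 1) =
      (List.ofFn fun i => yBold i (c i ((n : ℤ) - m))).prod * thetaTail c m := by
  have hblock : ((n - (m + 1) : ℕ) : ℤ) + 1 = n - m := by omega
  have hdrop := prod_drop_ofFn (fun j : Fin n =>
    (List.ofFn fun i : Fin n => yBold i (c i (((j : ℕ) : ℤ) + 1))).prod) ⟨n - (m + 1), by omega⟩
  simp only [hblock] at hdrop
  rw [thetaTail, hdrop, thetaTail, show n - (m + 1) + 1 = n - m by omega]

theorem isSweepSequence_thetaTail (c : Fin (n + 1) → ℤ → ℂˣ) (b : Spin (n + 1)) :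
    IsSweepSequence n (fun m i => (c (Fin.ofNat (n + 1) i) (((n + 1 : ℕ) : ℤ) - m) : ℂ))
      fun m S => mat (thetaTail c m) (minusSpin (n + 1) S) b := by
  intro m hm
  refine ⟨_, isSweep_mat (fun i => c i (((n + 1 : ℕ) : ℤ) - m)) (thetaTail c m) b, ?_, ?_⟩
  · rw [List.drop_of_length_le (by simp), List.prod_nil, one_mul]
  · rw [List.drop_zero, ← thetaTail_succ c (by omega)]

theorem mat_Theta_cutSpin_topSpin (c : Fin (n + 1) → ℤ → ℂˣ) :
    mat (Theta c) (cutSpin (n + 1)) (topSpin (n + 1)) = ∑ k ∈ Finset.range (n + 1),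
      stepWeightSum (fun m i => (c (Fin.ofNat (n + 1) i) (((n + 1 : ℕ) : ℤ) - m) : ℂ)) n k := by
  have hvanish : VanishesAbove n 0 fun S =>
      mat (thetaTail c 0) (minusSpin (n + 1) S) (topSpin (n + 1)) := by
    intro S hS hcard
    beta_reduce
    rw [thetaTail_zero, map_one,
      Matrix.one_apply_ne (minusSpin_ne_topSpin hS (Finset.card_pos.1 hcard))]
  have hone : mat (thetaTail c 0) (minusSpin (n + 1) ∅) (topSpin (n + 1)) = 1 := by
    rw [thetaTail_zero, map_one, minusSpin_empty, Matrix.one_apply_eq]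
  have happly := (isSweepSequence_thetaTail c _).apply_range hvanish hone le_rfl
  rwa [thetaTail_self, minusSpin_range] at happly

/-! ### Triangles -/

theorem exists_succAbove_eq_of_strictMono {f : Fin n → Fin (n + 1)} (hf : StrictMono f) :
    ∃ p : Fin (n + 1), p.succAbove = f := by
  obtain ⟨p, hp⟩ : ∃ p, (Finset.univ.image f)ᶜ = {p} := by
    rw [← Finset.card_eq_one, Finset.card_compl, Finset.card_image_of_injective _ hf.injective]
    simp
  refine ⟨p, ((Fin.strictMono_succAbove p).range_inj hf).1 ?_⟩
  rw [Fin.range_succAbove, ← Finset.coe_singleton, ← hp, Finset.coe_compl, compl_compl]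
  simp

theorem IsRowLabel.unique {t : TriArray n} {l : Fin n} {s s' : ℕ} (h : IsRowLabel t l s)
    (h' : IsRowLabel t l s') : s = s' := by
  wlog hlt : s < s' generalizing s s'
  · by_contra hne
    exact hne (this h' h (by omega)).symm
  obtain ⟨hpos, -, hentry⟩ := h
  obtain ⟨-, hle, hentry'⟩ := h'
  have heq := (hentry ⟨s - 1, by omega⟩).symm.trans (hentry' ⟨s - 1, by omega⟩)
  rw [if_neg (by grind), if_pos (by grind)] at heq
  omega

theorem IsRowLabel.rowLabel_eq {t : TriArray n} {l : Fin n} {s : ℕ} (h : IsRowLabel t l s) :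
    rowLabel t l = s :=
  IsRowLabel.unique (Nat.sInf_mem (s := {s | IsRowLabel t l s}) ⟨s, h⟩) h

theorem label₀_succ (t : TriArray n) (l : Fin n) : label₀ t (l + 1) = rowLabel t l := by
  rw [label₀, dif_pos ⟨by omega, l.2⟩]
  rfl

theorem label₀_zero (t : TriArray n) : label₀ t 0 = 1 :=
  dif_neg (by simp)

theorem IsRowLabel.le_and_le_succ {t : TriArray n} (ht : IsTriangle t) {l : Fin n}
    (hl : (l : ℕ) + 1 < n) {s s' : ℕ} (h : IsRowLabel t l s) (h' : IsRowLabel t ⟨l + 1, hl⟩ s') :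
    s ≤ s' ∧ s' ≤ s + 1 := by
  obtain ⟨hpos, hle, hentry⟩ := h
  obtain ⟨hpos', hle', hentry'⟩ := h'
  constructor <;> by_contra! hlt
  · have hinterlace := Fin.le_def.1 (ht.2 l hl ⟨s' - 1, by omega⟩).1
    rw [hentry, hentry', if_neg (by grind), if_pos (by grind), Fin.val_castSucc] at hinterlace
    omega
  · have hinterlace := Fin.lt_def.1 (ht.2 l hl ⟨s - 1, by grind⟩).2
    rw [hentry, hentry', if_neg (by grind), if_pos (by grind), Fin.val_succ] at hinterlace
    omega

namespace IsTriangle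

variable {t : TriArray n}

theorem strictMono_row (ht : IsTriangle t) (l : Fin n) : StrictMono (t l) := by
  obtain ⟨_ | l, hl⟩ := l
  · exact Subsingleton.strictMono (α := Fin 1) _
  · exact Fin.strictMono_iff_lt_succ.2 fun k =>
      (ht.2 ⟨l, by omega⟩ hl k).1.trans_lt (ht.2 ⟨l, by omega⟩ hl k).2

theorem last_le (ht : IsTriangle t) (l : Fin n) : (t l (Fin.last l) : ℕ) ≤ l + 2 := by
  obtain ⟨d, hd⟩ := Nat.exists_eq_add_of_lt l.2
  induction d generalizing l with
  | zero => exact (ht.1 l _).2.trans (by omega)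
  | succ d ih =>
    have hl : (l : ℕ) + 1 < n := by omega
    have hnext := ih ⟨l + 1, hl⟩ (by simp only; omega)
    have hinterlace := Fin.lt_def.1 (ht.2 l hl (Fin.last l)).2
    rw [Fin.succ_last] at hinterlace
    simp only [Nat.succ_eq_add_one] at hnext hinterlace
    omega

theorem exists_isRowLabel (ht : IsTriangle t) (l : Fin n) : ∃ s, IsRowLabel t l s := by
  have hle (k : Fin ((l : ℕ) + 1)) : (t l k : ℕ) ≤ l + 2 :=
    (Fin.le_def.1 ((ht.strictMono_row l).monotone k.le_last)).trans (ht.last_le l)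
  have hpos (k : Fin ((l : ℕ) + 1)) : 1 ≤ (t l k : ℕ) := (ht.1 l k).1
  obtain ⟨p, hp⟩ := exists_succAbove_eq_of_strictMono
    (f := fun k => (⟨t l k - 1, by grind⟩ : Fin ((l : ℕ) + 2))) fun k k' hk => by
      have := ht.strictMono_row l hk
      grind
  refine ⟨p + 1, by omega, by omega, fun k => ?_⟩
  have hentry := congrArg Fin.val (congrFun hp k)
  rw [Fin.succAbove] at hentry
  grind

theorem isRowLabel_label₀ (ht : IsTriangle t) (l : Fin n) : IsRowLabel t l (label₀ t (l + 1)) := by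
  obtain ⟨s, hs⟩ := ht.exists_isRowLabel l
  rwa [label₀_succ, hs.rowLabel_eq]

theorem label₀_succ_eq_or (ht : IsTriangle t) {r : ℕ} (hr : r < n) :
    label₀ t (r + 1) = label₀ t r ∨ label₀ t (r + 1) = label₀ t r + 1 := by
  have hrow := ht.isRowLabel_label₀ ⟨r, hr⟩
  cases r with
  | zero =>
    obtain ⟨hpos, hle, -⟩ := hrow
    simp only at hpos hle
    rw [label₀_zero]
    omega
  | succ r =>
    have hstep := (ht.isRowLabel_label₀ ⟨r, by omega⟩).le_and_le_succ ht hr hrow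
    simp only at hstep
    omega

end IsTriangle

/-- The triangle whose labels `(s_0, …, s_n)` increase exactly at the steps in `P`: `s_{r+1} =
s_r + 1` for `r ∈ P`, and `s_{r+1} = s_r` otherwise. -/
def triangleOf (n : ℕ) (P : Finset ℕ) : TriArray n := fun l k =>
  if (k : ℕ) < Nat.count (· ∈ P) (l + 1) then ⟨k + 1, by omega⟩ else ⟨k + 2, by omega⟩

/-- The set of those `r < n` such that the labels of a triangle satisfy `s_{r+1} = s_r + 1`. -/
noncomputable def stepSet (t : TriArray n) : Finset ℕ :=
  {r ∈ Finset.range n | label₀ t (r + 1) = label₀ t r + 1}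

theorem triangleOf_apply (P : Finset ℕ) (l : Fin n) (k : Fin ((l : ℕ) + 1)) :
    (triangleOf n P l k : ℕ) =
      if (k : ℕ) < Nat.count (· ∈ P) (l + 1) then (k : ℕ) + 1 else k + 2 := by
  unfold triangleOf
  split_ifs <;> rfl

theorem isTriangle_triangleOf (P : Finset ℕ) : IsTriangle (triangleOf n P) := by
  refine ⟨fun l k => ?_, fun l hl k => ?_⟩
  · rw [triangleOf_apply]
    grind
  · have hcount := Nat.count_succ (· ∈ P) (l + 1)
    rw [Fin.le_def, Fin.lt_def]
    simp only [triangleOf_apply, Fin.val_castSucc, Fin.val_succ]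
    grind

theorem isRowLabel_triangleOf (P : Finset ℕ) (l : Fin n) :
    IsRowLabel (triangleOf n P) l (Nat.count (· ∈ P) (l + 1) + 1) := by
  refine ⟨by omega, by have := Nat.count_le (p := (· ∈ P)) (n := l + 1); omega, fun k => ?_⟩
  simp only [triangleOf_apply, Nat.add_lt_add_iff_right]

theorem label₀_triangleOf (P : Finset ℕ) {r : ℕ} (hr : r ≤ n) :
    label₀ (triangleOf n P) r = Nat.count (· ∈ P) r + 1 := by
  cases r with
  | zero => rw [label₀_zero, Nat.count_zero]
  | succ r => exact (label₀_succ _ ⟨r, hr⟩).trans (isRowLabel_triangleOf P ⟨r, hr⟩).rowLabel_eq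

theorem IsTriangle.label₀_eq_count {t : TriArray n} (ht : IsTriangle t) {r : ℕ} (hr : r ≤ n) :
    label₀ t r = Nat.count (· ∈ stepSet t) r + 1 := by
  induction r with
  | zero => rw [label₀_zero, Nat.count_zero]
  | succ r ih =>
    have hstep := ht.label₀_succ_eq_or hr
    have hmem : r ∈ stepSet t ↔ label₀ t (r + 1) = label₀ t r + 1 := by
      rw [stepSet, Finset.mem_filter, and_iff_right (Finset.mem_range.2 hr)]
    specialize ih (by omega)
    rw [Nat.count_succ]
    split_ifs <;> grind

theorem IsTriangle.triangleOf_stepSet {t : TriArray n} (ht : IsTriangle t) :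
    triangleOf n (stepSet t) = t := by
  funext l k
  ext
  rw [triangleOf_apply, (ht.isRowLabel_label₀ l).2.2 k, ht.label₀_eq_count l.2]
  simp only [Nat.add_lt_add_iff_right]

theorem stepSet_triangleOf {P : Finset ℕ} (hP : P ⊆ Finset.range n) :
    stepSet (triangleOf n P) = P := by
  ext r
  rw [stepSet, Finset.mem_filter]
  refine ⟨fun ⟨hr, hstep⟩ => ?_, fun hr => ⟨hP hr, ?_⟩⟩
  · rw [Finset.mem_range] at hr
    rw [label₀_triangleOf P hr, label₀_triangleOf P hr.le, Nat.count_succ] at hstep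
    grind
  · have hrn := Finset.mem_range.1 (hP hr)
    rw [label₀_triangleOf P hrn, label₀_triangleOf P hrn.le, Nat.count_succ, if_pos hr]

theorem triangleOf_range (n : ℕ) : triangleOf n (Finset.range n) = lowestTriangle n := by
  funext l k
  ext
  have hcount : Nat.count (· ∈ Finset.range n) (l + 1) = l + 1 :=
    Nat.count_iff_forall.2 fun _ hr => Finset.mem_range.2 (by omega)
  rw [triangleOf_apply, hcount, if_pos k.2]
  rfl

theorem sum_triangles_sdiff_lowestTriangle {M : Type*} [AddCommMonoid M] (f : TriArray n → M) :
    ∑ δ ∈ triangles n \ {lowestTriangle n}, f δ =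
      ∑ P ∈ (Finset.range n).powerset \ {Finset.range n}, f (triangleOf n P) := by
  have hstepSet {t : TriArray n} (ht : t ∈ triangles n \ {lowestTriangle n}) :
      triangleOf n (stepSet t) = t := by
    simp only [triangles, Finset.mem_sdiff, Finset.mem_filter] at ht
    exact ht.1.2.triangleOf_stepSet
  refine Finset.sum_nbij' stepSet (triangleOf n) (fun t ht => ?_) (fun P hP => ?_)
    (fun t ht => hstepSet ht) (fun P hP => ?_) (fun t ht => by rw [hstepSet ht])
  · have heq := hstepSet ht
    simp only [Finset.mem_sdiff, Finset.mem_singleton, Finset.mem_powerset] at ht ⊢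
    refine ⟨Finset.filter_subset _ _, fun hrange => ht.2 ?_⟩
    rw [← heq, hrange, triangleOf_range]
  · simp only [Finset.mem_sdiff, Finset.mem_singleton, Finset.mem_powerset] at hP
    simp only [triangles, Finset.mem_sdiff, Finset.mem_filter_univ, Finset.mem_singleton]
    refine ⟨isTriangle_triangleOf P, fun hlowest => hP.2 ?_⟩
    rw [← stepSet_triangleOf hP.1, hlowest, ← triangleOf_range, stepSet_triangleOf subset_rfl]
  · exact stepSet_triangleOf (Finset.mem_powerset.1 (Finset.mem_sdiff.1 hP).1)

theorem label_triangleOf (P : Finset ℕ) {r : ℕ} (hr : r ≤ n) :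
    label (triangleOf n P) r = Nat.count (· ∈ P) r + 1 := by
  rw [label, if_neg (by omega), label₀_triangleOf P hr]

theorem label_triangleOf_last (P : Finset ℕ) :
    label (triangleOf n P) (n + 1) = Nat.count (· ∈ P) (n - 1) + 2 := by
  rw [label, if_pos rfl, label₀_triangleOf P (by omega)]

section RowTypes

variable (P : Finset ℕ)

theorem isTypeI_triangleOf_iff {i : ℕ} (hi : i + 1 < n) :
    IsTypeI (triangleOf n P) (i + 1) ↔ i ∉ P ∧ i + 1 ∈ P := by
  rw [IsTypeI, Nat.add_sub_cancel, label_triangleOf P hi, label_triangleOf P hi.le,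
    label_triangleOf P (by omega), Nat.count_succ _ (i + 1), Nat.count_succ _ i]
  split_ifs <;> simp [*]

theorem isTypeIV_triangleOf_iff {i : ℕ} (hi : i + 1 < n) :
    IsTypeIV (triangleOf n P) (i + 1) ↔ i ∈ P ∧ i + 1 ∉ P := by
  rw [IsTypeIV, Nat.add_sub_cancel, label_triangleOf P hi, label_triangleOf P hi.le,
    label_triangleOf P (by omega), Nat.count_succ _ (i + 1), Nat.count_succ _ i]
  split_ifs <;> simp [*]

theorem isTypeI_triangleOf_last_iff : IsTypeI (triangleOf (n + 1) P) (n + 1) ↔ n ∉ P := by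
  rw [IsTypeI, label_triangleOf_last, label_triangleOf P le_rfl, Nat.add_sub_cancel,
    label_triangleOf P (Nat.le_succ n), Nat.count_succ]
  split_ifs <;> simp [*]

theorem isTypeIV_triangleOf_last_iff : IsTypeIV (triangleOf (n + 1) P) (n + 1) ↔ n ∈ P := by
  rw [IsTypeIV, label_triangleOf_last, label_triangleOf P le_rfl, Nat.add_sub_cancel,
    label_triangleOf P (Nat.le_succ n), Nat.count_succ]
  split_ifs <;> simp [*]

end RowTypes

theorem monoBar_triangleOf (c : Fin (n + 1) → ℤ → ℂˣ) {P : Finset ℕ}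
    (hP : P ⊆ Finset.range (n + 1)) :
    (monoBar (triangleOf (n + 1) P) c : ℂ) =
      stepWeight (fun m i => (c (Fin.ofNat (n + 1) i) (((n + 1 : ℕ) : ℤ) - m) : ℂ)) n P := by
  have hlabel {r : ℕ} (hr : r ≤ n + 1) : ((n + 1 : ℕ) : ℤ) - label (triangleOf (n + 1) P) r + 1 =
      ((n + 1 : ℕ) : ℤ) - Nat.count (· ∈ P) r := by
    rw [label_triangleOf P hr]
    push_cast
    ring
  have hlast : Fin.ofNat (n + 1) n = Fin.last n := Fin.ext (by simp)
  rw [monoBar, mono, Fin.prod_univ_castSucc, Units.val_mul, stepWeight, partialWeight,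
    Units.coe_prod, Finset.prod_range]
  refine congrArg₂ _ (Finset.prod_congr rfl fun i _ => ?_) ?_
  · have hi : Fin.ofNat (n + 1) i = i.castSucc := Fin.ext (by simp)
    simp only [Fin.val_castSucc, isTypeI_triangleOf_iff P (Nat.succ_lt_succ i.2),
      isTypeIV_triangleOf_iff P (Nat.succ_lt_succ i.2), hlabel (show (i : ℕ) + 1 ≤ n + 1 by omega),
      rowWeight, hi]
    split_ifs <;> simp
  · simp only [Fin.val_last, isTypeI_triangleOf_last_iff, isTypeIV_triangleOf_last_iff,
      hlabel le_rfl, count_mem_of_subset_range hP, hlast]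
    split_ifs <;> simp

theorem mat_Theta_eq_sum_monoBar (c : Fin (n + 1) → ℤ → ℂˣ) :
    mat (Theta c) (cutSpin (n + 1)) (topSpin (n + 1)) =
      ∑ δ ∈ triangles (n + 1) \ {lowestTriangle (n + 1)}, (monoBar δ c : ℂ) := by
  rw [mat_Theta_cutSpin_topSpin, ← sum_stepWeight, sum_triangles_sdiff_lowestTriangle]
  refine Finset.sum_congr rfl fun P hP => (monoBar_triangleOf c ?_).symm
  exact Finset.mem_powerset.1 (Finset.mem_sdiff.1 hP).1

end TypeB

theorem mainTheorem7 (n : ℕ) (hn : 1 ≤ n) (w₀ : Equiv.Perm (Weight n)) (hw₀ : IsLongest w₀) :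
    (∃! D : G n → ℂ,
      IsGeneralizedMinor (fundWeight (lastIdx n hn))
        (w₀ (simpleReflection (lastIdx n hn) (fundWeight (lastIdx n hn))))
        (fundWeight (lastIdx n hn)) D) ∧
    ∀ D : G n → ℂ,
      IsGeneralizedMinor (fundWeight (lastIdx n hn))
        (w₀ (simpleReflection (lastIdx n hn) (fundWeight (lastIdx n hn))))
        (fundWeight (lastIdx n hn)) D →
      ∀ c : Fin n → ℤ → ℂˣ,
        D (Theta c) = ∑ δ ∈ triangles n \ {lowestTriangle n}, (monoBar δ c : ℂ) := by
  refine ⟨⟨_, (isGeneralizedMinor_longest_iff hn hw₀ _).2 rfl, fun D hD =>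
    (isGeneralizedMinor_longest_iff hn hw₀ D).1 hD⟩, fun D hD c => ?_⟩
  obtain rfl := (isGeneralizedMinor_longest_iff hn hw₀ D).1 hD
  obtain ⟨k, rfl⟩ := Nat.exists_eq_add_of_le' hn
  exact mat_Theta_eq_sum_monoBar c
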